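/- Let $d \ge 1$ and $k \ge 2$ be integers, let $s < 0$ and $\sigma \in \mathbb{R}$, and let $(u_0,u_1) \in H^s(\mathbb{R}^d) \times H^s(\mathbb{R}^d)$. Consider the $d$-dimensional generalized improved Boussinesq equation $$\partial_t^2 u - \Delta u - \partial_t^2 \Delta u = \Delta(u^k). \qquad (*)$$ Then for every $\varepsilon > 0$ there exist $T>0$, a solution $u_\varepsilon$ of $(*)$ on $[0,T]\times\mathbb{R}^d$, and a time $t_\varepsilon \in (0,\varepsilon)$ with $t_\varepsilon \le T$, such that $$\| (u_\varepsilon(0), \partial_t u_\varepsilon(0)) - (u_0,u_1) \|_{H^s \times H^s} < \varepsilon, \qquad u_\varepsilon(t_\varepsilon) \in H^\sigma(\mathbb{R}^d) \quad\text{and}\quad \| u_\varepsilon(t_\varepsilon) \|_{H^\sigma} > \varepsilon^{-1}.$$ Here functions and distributions are complex-valued, $\|f\|_{H^s} = \| (1+|\xi|^2)^{s/2} \widehat f(\xi) \|_{L^2_\xi}$, and a solution on $[0,T]$ means a function $u \in C^2([0,T]; \mathcal{F}L^1(\mathbb{R}^d))$ that satisfies $(*)$ at each time $t\in[0,T]$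 in the sense of tempered distributions on $\mathbb{R}^d$, where $\mathcal{F}L^1(\mathbb{R}^d)$ is the Wiener algebra of functions with integrable Fourier transform, normed by $\|\widehat f\|_{L^1}$. -/

import Mathlib

open MeasureTheory Set FourierTransform TemperedDistribution
open scoped SchwartzMap Laplacian ENNReal BoundedContinuousFunction

noncomputable section

namespace GIBq

/-- Euclidean space `ℝ^d`. -/
abbrev Space (d : ℕ) := EuclideanSpace ℝ (Fin d)

/-- The norm of `H^s(ℝ^d)`, with value `∞` off `H^s(ℝ^d)`: the `L²` norm of the (unique) `L²`
function representing `𝓕⁻¹ (⟨ξ⟩^s 𝓕 f)`, where `⟨ξ⟩ = (1 + |ξ|²)^(1/2)`. -/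
def sobolevNorm {d : ℕ} (s : ℝ) (f : 𝓢'(Space d, ℂ)) : ℝ≥0∞ :=
  ⨅ (g : Lp ℂ 2 (volume : Measure (Space d))) (_ : besselPotential (Space d) ℂ s f = g), ‖g‖ₑ

theorem sobolevNorm_eq {d : ℕ} {s : ℝ} {f : 𝓢'(Space d, ℂ)}
    {g : Lp ℂ 2 (volume : Measure (Space d))} (h : besselPotential (Space d) ℂ s f = g) :
    sobolevNorm s f = ‖g‖ₑ := by
  refine le_antisymm (iInf₂_le g h) (le_iInf₂ fun g' h' => le_of_eq ?_)
  have hinj := LinearMap.ker_eq_bot.mp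
    (Lp.ker_toTemperedDistributionCLM_eq_bot (F := ℂ) (μ := (volume : Measure (Space d))) (p := 2))
  rw [hinj (a₁ := g) (a₂ := g') (by
    change (g : 𝓢'(Space d, ℂ)) = (g' : 𝓢'(Space d, ℂ))
    rw [← h, ← h'])]

theorem sobolevNorm_lt_top_iff {d : ℕ} {s : ℝ} {f : 𝓢'(Space d, ℂ)} :
    sobolevNorm s f < ∞ ↔ MemSobolev s 2 f := by
  constructor
  · intro h
    obtain ⟨g, hg⟩ := iInf_lt_iff.mp h
    obtain ⟨hg', -⟩ := iInf_lt_iff.mp hg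
    exact ⟨g, hg'⟩
  · rintro ⟨g, hg⟩
    rw [sobolevNorm_eq hg]
    exact enorm_lt_top

/-- The norm of the product space `H^s(ℝ^d) × H^s(ℝ^d)`. -/
def sobolevPairNorm {d : ℕ} (s : ℝ) (f g : 𝓢'(Space d, ℂ)) : ℝ≥0∞ :=
  sobolevNorm s f + sobolevNorm s g

/-- The Wiener algebra `ℱL¹(ℝ^d)` of functions with integrable Fourier transform, normed by
`‖𝓕 f‖_{L¹}`. An element is recorded by its Fourier transform, so that the identification with
`L¹(ℝ^d)` is isometric; the function itself is `fn`. -/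
abbrev WienerAlgebra (d : ℕ) := Lp ℂ 1 (volume : Measure (Space d))

/-- The bounded continuous function `x ↦ ∫ e^{2πi x·ξ} g(ξ) dξ` whose Fourier transform is the
integrable function `g`. -/
def fn {d : ℕ} (g : WienerAlgebra d) : Space d →ᵇ ℂ :=
  BoundedContinuousFunction.ofNormedAddCommGroup (𝓕⁻ (g : Space d → ℂ))
    (by
      rw [Real.fourierInv_eq_fourier_comp_neg]
      exact VectorFourier.fourierIntegral_continuous Real.continuous_fourierChar
        (by exact continuous_inner) ((L1.integrable_coeFn g).comp_neg))
    (∫ ξ, ‖g ξ‖)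
    (fun x => by
      rw [Real.fourierInv_eq]
      refine (norm_integral_le_integral_norm _).trans (le_of_eq ?_)
      simp)

/-- The tempered distribution `φ ↦ ∫ φ(x) f(x) dx` of a bounded continuous function `f`. -/
def toDist {d : ℕ} (f : Space d →ᵇ ℂ) : 𝓢'(Space d, ℂ) :=
  ((f.memLp_top (μ := volume)).toLp (f : Space d → ℂ) : Lp ℂ ∞ (volume : Measure (Space d)))

theorem toDist_apply {d : ℕ} (f : Space d →ᵇ ℂ) (φ : 𝓢(Space d, ℂ)) :
    toDist f φ = ∫ x, φ x * f x := by
  rw [toDist, Lp.toTemperedDistribution_apply]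
  refine integral_congr_ae ?_
  filter_upwards [(f.memLp_top (μ := volume)).coeFn_toLp] with x hx
  rw [hx, smul_eq_mul]

/-- The first time derivative at time `t` of a curve on `[0, T]` (one-sided at the end points). -/
def dt {d : ℕ} (T : ℝ) (u : ℝ → WienerAlgebra d) (t : ℝ) : WienerAlgebra d :=
  derivWithin u (Icc 0 T) t

/-- The second time derivative at time `t` of a curve on `[0, T]`. -/
def dtt {d : ℕ} (T : ℝ) (u : ℝ → WienerAlgebra d) (t : ℝ) : WienerAlgebra d :=
  derivWithin (dt T u) (Icc 0 T) t

/-- `u` is a solution on `[0, T]` of `u_tt - Δu - Δu_tt = Δ(u^k)` in the Wiener algebra: it is of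
class `C²` in time with values in the Wiener algebra, and the equation holds at each time in the
sense of tempered distributions on `ℝ^d`. -/
structure IsSolution {d : ℕ} (k : ℕ) (T : ℝ) (u : ℝ → WienerAlgebra d) : Prop where
  contDiffOn : ContDiffOn ℝ 2 u (Icc 0 T)
  equation : ∀ t ∈ Icc 0 T,
    toDist (fn (dtt T u t)) - Δ (toDist (fn (u t))) - Δ (toDist (fn (dtt T u t)))
      = Δ (toDist (fn (u t) ^ k))

end GIBq

end

open scoped NNReal Topology Convolution
open Metric Filter

/-! ### Second-order ordinary differential equations in a Banach space. -/

section SecondOrder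

/-! On the Fourier side the equation reads `û_tt = -m (û + (u^k)^)` with a symbol `m` bounded by 1.
It is thus an ODE with locally Lipschitz right-hand side in a convolution algebra, and inflation
comes from the power sending high frequencies to low ones.

Write `k = n + 1`. Approximate `u₀` and `u₁` by data with compactly supported Fourier transform, and
add to the first `R β_N`, where `β_N` has Fourier transform two copies of a bump `q`, centred at `N
e` and `-n N e`. Since `s < 0`, `β_N` tends to 0 in `H^s`. In `β_N^k`, the product of `n` factors of
the first kind and one of the second has frequency centre 0; every other product oscillates. Hence
`β_N` tends weakly to 0 but `β_N^k` tends weakly to `(n + 1) g^k`, `g` being the inverse Fourier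
transform of `q` (`tendsto_toDist_twoBumps_pow`).

Put `R = ρ²` and `T = τ / ρ^n`, so that `T² R^n = τ²`. Existence on `[0, T]` is Picard-Lindelöf at
the natural time scale of amplitude `R` (`exists_isSolution`). Pair a second-order Taylor expansion
in time with the fixed test function `(1 - Δ) ζ`: the nonlinearity contributes about `τ² R κ / 2`,
where `κ = ⟨(n + 1) g^k, Δ ζ⟩ ≠ 0`, while the errors are `O(τ² + τ³ R)`, a constant, and `R` times a
pairing that vanishes as `N → ∞` (`exists_isSolution_lower_bound`). Choosing `τ` small, `ρ` large,
and `N` last makes the pairing large. It is controlled by the `H^σ` norm for any `σ`, however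
negative.

To have `u(t)` in `H^σ` for any `σ`, however large, the ODE is solved for `e^{δ|ξ|} û` in the space
of continuous, bounded and integrable functions. The weight is submultiplicative, so the algebra
bounds do not depend on `δ`; with `δ = 1 / (N + 1)` the weighted norms of the bumps stay bounded in
`N`. -/

theorem IsPicardLindelof.exists_hasDerivWithinAt_and_norm_sub_le {E : Type*}
    [NormedAddCommGroup E] [NormedSpace ℝ E] [CompleteSpace E] {f : ℝ → E → E} {tmin tmax : ℝ}
    {t₀ : Icc tmin tmax} {x : E} {a L K : ℝ≥0} (hf : IsPicardLindelof f t₀ x a 0 L K) :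
    ∃ α : ℝ → E, α t₀ = x ∧ ∀ t ∈ Icc tmin tmax,
      HasDerivWithinAt α (f t (α t)) (Icc tmin tmax) t ∧ ‖α t - x‖ ≤ L * |t - t₀| := by
  have hx : x ∈ closedBall x ((0 : ℝ≥0) : ℝ) := mem_closedBall_self le_rfl
  obtain ⟨α, hα⟩ := ODE.FunSpace.exists_isFixedPt_next hf hx
  have h0 : α.compProj t₀ = x := by
    rw [ODE.FunSpace.compProj_val, ← hα, ODE.FunSpace.next_apply₀]
  refine ⟨α.compProj, h0, fun t ht ↦ ⟨?_, ?_⟩⟩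
  · apply ODE.hasDerivWithinAt_picard_Icc t₀.2 hf.continuousOn_uncurry
      α.continuous_compProj.continuousOn (fun _ ht' ↦ α.compProj_mem_closedBall hf.mul_max_le)
      x ht |>.congr_of_mem _ ht
    intro t' ht'
    nth_rw 1 [← hα]
    rw [ODE.FunSpace.compProj_of_mem ht', ODE.FunSpace.next_apply]
  -- The fixed point lives in a space of `L`-Lipschitz curves, which yields the displacement bound.
  · have h : ‖α.compProj t - α.compProj t₀‖ ≤ L * |t - t₀| := by
      rw [ODE.FunSpace.compProj_of_mem ht, ODE.FunSpace.compProj_val, ← dist_eq_norm]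
      exact α.lipschitzWith.dist_le_mul _ _
    rwa [h0] at h

/-- Picard-Lindelöf for the pair `(v, l⁻¹ v')`: rescaling the velocity by the inverse time scale `l`
gives both components size `r` and the vector field size `l c r` on the ball of radius `r` about the
data, so the solution stays in that ball for time `1 / (l c)`. -/
theorem exists_solution_second_order {V : Type*} [NormedAddCommGroup V] [NormedSpace ℝ V]
    [CompleteSpace V] {F : V → V} {r l c T : ℝ} {K : ℝ≥0} (hr : 0 ≤ r) (hl : 0 < l) (hc : 2 ≤ c)
    (hT : 0 ≤ T) (hlT : l * c * T ≤ 1) (hF : ∀ x, ‖x‖ ≤ 2 * r → ‖F x‖ ≤ l ^ 2 * (c * r))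
    (hK : LipschitzOnWith K F (closedBall 0 (2 * r))) {v₀ v₁ : V} (h₀ : ‖v₀‖ ≤ r)
    (h₁ : ‖v₁‖ ≤ l * r) :
    ∃ v w : ℝ → V, v 0 = v₀ ∧ w 0 = v₁ ∧ ∀ t ∈ Icc 0 T,
      HasDerivWithinAt v (w t) (Icc 0 T) t ∧ HasDerivWithinAt w (F (v t)) (Icc 0 T) t ∧
      ‖v t‖ ≤ 2 * r ∧ ‖v t - v₀‖ ≤ l * c * r * t := by
  let G : V × V → V × V := fun z => (l • z.2, l⁻¹ • F z.1)
  let x₀ : V × V := (v₀, l⁻¹ • v₁)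
  have hx₀ : ‖x₀‖ ≤ r := by
    refine max_le h₀ ?_
    rw [norm_smul, Real.norm_of_nonneg (by positivity), inv_mul_le_iff₀ hl]
    exact h₁
  have hball : ∀ z ∈ closedBall x₀ r, ‖z‖ ≤ 2 * r := fun z hz => by
    have := norm_le_norm_add_norm_sub' z x₀
    rw [mem_closedBall, dist_eq_norm] at hz
    rw [← dist_eq_norm, dist_comm, dist_eq_norm, norm_sub_rev] at this
    linarith
  have hG : ∀ z ∈ closedBall x₀ r, ‖G z‖ ≤ l * c * r := fun z hz => by
    have h := hball z hz
    refine max_le ?_ ?_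
    · change ‖l • z.2‖ ≤ _
      rw [norm_smul, Real.norm_of_nonneg hl.le]
      have : ‖z.2‖ ≤ 2 * r := (norm_snd_le z).trans h
      calc l * ‖z.2‖ ≤ l * (c * r) := by gcongr; exact this.trans (by gcongr)
        _ = _ := by ring
    · change ‖l⁻¹ • F z.1‖ ≤ _
      rw [norm_smul, Real.norm_of_nonneg (by positivity), inv_mul_le_iff₀ hl]
      refine (hF _ ((norm_fst_le z).trans h)).trans (le_of_eq (by ring))
  have hLip : LipschitzOnWith (‖l‖₊ + ‖l⁻¹‖₊ * K) G (closedBall x₀ r) := by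
    refine LipschitzOnWith.of_dist_le_mul fun y hy z hz => ?_
    rw [NNReal.coe_add, NNReal.coe_mul, coe_nnnorm, coe_nnnorm, add_mul]
    refine max_le ?_ ?_
    · change dist (l • y.2) (l • z.2) ≤ _
      rw [dist_smul₀]
      have : dist y.2 z.2 ≤ dist y z := le_max_right _ _
      calc ‖l‖ * dist y.2 z.2 ≤ ‖l‖ * dist y z := by gcongr
        _ ≤ _ := le_add_of_nonneg_right (by positivity)
    · change dist (l⁻¹ • F y.1) (l⁻¹ • F z.1) ≤ _
      rw [dist_smul₀]
      have h1 : dist y.1 z.1 ≤ dist y z := le_max_left _ _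
      have h2 := hK.dist_le_mul y.1 (mem_closedBall_zero_iff.2 ((norm_fst_le y).trans (hball y hy)))
        z.1 (mem_closedBall_zero_iff.2 ((norm_fst_le z).trans (hball z hz)))
      calc ‖l⁻¹‖ * dist (F y.1) (F z.1) ≤ ‖l⁻¹‖ * (K * dist y z) := by
            gcongr; exact h2.trans (by gcongr)
        _ = ‖l⁻¹‖ * K * dist y z := by ring
        _ ≤ _ := le_add_of_nonneg_left (by positivity)
  have hpos : 0 ≤ l * c * r := by positivity
  have hPL : IsPicardLindelof (fun _ => G) (tmin := 0) (tmax := T) ⟨0, le_rfl, hT⟩ x₀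
      (⟨r, hr⟩ : ℝ≥0) 0 (⟨l * c * r, hpos⟩ : ℝ≥0) (‖l‖₊ + ‖l⁻¹‖₊ * K) := by
    refine IsPicardLindelof.of_time_independent hG hLip ?_
    simp only [sub_zero, sub_self, max_eq_left hT, NNReal.coe_zero]
    calc l * c * r * T = (l * c * T) * r := by ring
      _ ≤ 1 * r := by gcongr
      _ = r := one_mul r
  obtain ⟨α, hα0, hα⟩ := hPL.exists_hasDerivWithinAt_and_norm_sub_le
  refine ⟨fun t => (α t).1, fun t => l • (α t).2, by simp [hα0, x₀],
    by simp [hα0, x₀, hl.ne'], fun t ht => ?_⟩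
  obtain ⟨hd, hn⟩ := hα t ht
  simp only [sub_zero, abs_of_nonneg ht.1] at hn
  have hd1 : HasDerivWithinAt (fun t => (α t).1) (G (α t)).1 (Icc 0 T) t :=
    (ContinuousLinearMap.fst ℝ V V).hasFDerivAt.comp_hasDerivWithinAt t hd
  have hd2 : HasDerivWithinAt (fun t => (α t).2) (G (α t)).2 (Icc 0 T) t :=
    (ContinuousLinearMap.snd ℝ V V).hasFDerivAt.comp_hasDerivWithinAt t hd
  refine ⟨hd1, ?_, ?_, (norm_fst_le (α t - x₀)).trans hn⟩
  · have := hd2.const_smul l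
    simpa [G, smul_smul, hl.ne'] using! this
  · refine (norm_fst_le _).trans (hball _ ?_)
    rw [mem_closedBall, dist_eq_norm]
    refine hn.trans ?_
    calc l * c * r * t ≤ l * c * r * T := by gcongr; exact ht.2
      _ = (l * c * T) * r := by ring
      _ ≤ 1 * r := by gcongr
      _ = r := one_mul r

end SecondOrder

/-! ### Powers for a biadditive product. -/

section IteratedProduct

/-- The power `x ^ (n + 1)`, bracketed to the right, for a possibly non-associative product. -/
def iterMul {V : Type*} (B : V → V → V) : ℕ → V → V
  | 0, x => x
  | n + 1, x => B x (iterMul B n x)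

variable {V : Type*} [NormedAddCommGroup V] {B : V → V → V}

theorem norm_iterMul_le (hB : ∀ x y, ‖B x y‖ ≤ ‖x‖ * ‖y‖) (n : ℕ) (x : V) :
    ‖iterMul B n x‖ ≤ ‖x‖ ^ (n + 1) := by
  induction n with
  | zero => simp [iterMul]
  | succ n ih =>
    rw [iterMul, pow_succ']
    exact (hB _ _).trans (by gcongr)

/-- Telescoping, one factor at a time; the constant is the derivative of `t ^ (n + 1)` at `M`. -/
theorem norm_iterMul_sub_le (hB : ∀ x y, ‖B x y‖ ≤ ‖x‖ * ‖y‖)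
    (hl : ∀ x y z, B (x - y) z = B x z - B y z) (hr : ∀ x y z, B x (y - z) = B x y - B x z)
    {M : ℝ} (n : ℕ) {x y : V} (hx : ‖x‖ ≤ M) (hy : ‖y‖ ≤ M) :
    ‖iterMul B n x - iterMul B n y‖ ≤ (n + 1) * M ^ n * ‖x - y‖ := by
  have hM : 0 ≤ M := (norm_nonneg x).trans hx
  induction n with
  | zero => simp [iterMul]
  | succ n ih =>
    have h : iterMul B (n + 1) x - iterMul B (n + 1) y
        = B (x - y) (iterMul B n x) + B y (iterMul B n x - iterMul B n y) := by
      rw [iterMul, iterMul, hl, hr]; abel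
    rw [h]
    have h1 : ‖B (x - y) (iterMul B n x)‖ ≤ ‖x - y‖ * M ^ (n + 1) :=
      (hB _ _).trans (by gcongr; exact (norm_iterMul_le hB n x).trans (by gcongr))
    have h2 : ‖B y (iterMul B n x - iterMul B n y)‖ ≤ M * ((n + 1) * M ^ n * ‖x - y‖) :=
      (hB _ _).trans (by gcongr)
    refine (norm_add_le _ _).trans ((add_le_add h1 h2).trans (le_of_eq ?_))
    push_cast; ring

end IteratedProduct

/-! ### The Banach space of weighted Fourier transforms and its product. -/

noncomputable section

namespace GIBq

/-- The pairs consisting of a bounded continuous integrable function and its class in `L¹`. -/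
def ciSubmodule (d : ℕ) : Submodule ℝ ((Space d →ᵇ ℂ) × Lp ℂ 1 (volume : Measure (Space d))) where
  carrier := {p | (p.2 : Space d → ℂ) =ᵐ[volume] p.1}
  zero_mem' := Lp.coeFn_zero _ _ _
  add_mem' {p q} hp hq := by
    filter_upwards [show _ =ᵐ[volume] _ from hp, show _ =ᵐ[volume] _ from hq,
      Lp.coeFn_add p.2 q.2] with x h1 h2 h3
    exact h3.trans (congrArg₂ (· + ·) h1 h2)
  smul_mem' c p hp := by
    filter_upwards [show _ =ᵐ[volume] _ from hp, Lp.coeFn_smul c p.2] with x h1 h2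
    exact h2.trans (congrArg (c • ·) h1)

/-- An `L¹` limit is an almost everywhere limit along a subsequence, and must there agree with the
uniform limit. This makes `CI d` complete. -/
theorem isClosed_ciSubmodule (d : ℕ) :
    IsClosed (ciSubmodule d : Set ((Space d →ᵇ ℂ) × Lp ℂ 1 (volume : Measure (Space d)))) := by
  refine IsSeqClosed.isClosed fun p q hp hpq => ?_
  have h1 := (continuous_fst.tendsto q).comp hpq
  have h2 := (continuous_snd.tendsto q).comp hpq
  have hm := tendstoInMeasure_of_tendsto_Lp h2
  obtain ⟨ns, hns, hae⟩ := hm.exists_seq_tendsto_ae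
  have hp' : ∀ᵐ x, ∀ n, (p n).2 x = (p n).1 x := ae_all_iff.2 hp
  change (q.2 : Space d → ℂ) =ᵐ[volume] q.1
  filter_upwards [hae, hp'] with x hx hpx
  refine tendsto_nhds_unique hx ?_
  have h3 : Tendsto (fun i => (p (ns i)).1 x) atTop (𝓝 (q.1 x)) :=
    ((continuous_eval_const (F := Space d →ᵇ ℂ) x).tendsto q.1).comp
      (h1.comp hns.tendsto_atTop)
  exact h3.congr fun i => (hpx _).symm

/-- The Banach space of bounded continuous integrable functions, with the maximum of the supremum
norm and the `L¹` norm. -/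
def CI (d : ℕ) : Type := ciSubmodule d

instance (d : ℕ) : NormedAddCommGroup (CI d) := inferInstanceAs (NormedAddCommGroup (ciSubmodule d))
instance (d : ℕ) : NormedSpace ℝ (CI d) := inferInstanceAs (NormedSpace ℝ (ciSubmodule d))
instance (d : ℕ) : CompleteSpace (CI d) := (isClosed_ciSubmodule d).completeSpace_coe

variable {d : ℕ}

instance : CoeFun (CI d) (fun _ => Space d → ℂ) := ⟨fun f => f.1.1⟩

theorem CI.coe_ae (f : CI d) : (f.1.2 : Space d → ℂ) =ᵐ[volume] f := f.2

theorem CI.continuous (f : CI d) : Continuous f := f.1.1.continuous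

theorem CI.integrable (f : CI d) : Integrable f := (L1.integrable_coeFn f.1.2).congr f.coe_ae

theorem CI.norm_apply_le (f : CI d) (x : Space d) : ‖f x‖ ≤ ‖f‖ :=
  (f.1.1.norm_coe_le_norm x).trans (norm_fst_le f.1)

theorem CI.integral_norm_le (f : CI d) : ∫ x, ‖f x‖ ≤ ‖f‖ := by
  refine le_trans (le_of_eq ?_) (norm_snd_le f.1)
  rw [L1.norm_eq_integral_norm]
  exact integral_congr_ae (by filter_upwards [f.coe_ae] with x hx; rw [hx])

@[ext] theorem CI.ext {f g : CI d} (h : ∀ x, f x = g x) : f = g := by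
  refine Subtype.ext (Prod.ext (BoundedContinuousFunction.ext h) (Lp.ext ?_))
  filter_upwards [f.coe_ae, g.coe_ae] with x hf hg
  rw [hf, hg, h]

@[simp] theorem CI.add_apply (f g : CI d) (x : Space d) : (f + g) x = f x + g x := rfl
@[simp] theorem CI.sub_apply (f g : CI d) (x : Space d) : (f - g) x = f x - g x := rfl
@[simp] theorem CI.neg_apply (f : CI d) (x : Space d) : (-f) x = -f x := rfl
@[simp] theorem CI.smul_apply (c : ℝ) (f : CI d) (x : Space d) : (c • f) x = c * f x := rfl

theorem CI.bddAbove (f : CI d) : BddAbove (range fun x => ‖f x‖) :=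
  ⟨‖f‖, by rintro _ ⟨x, rfl⟩; exact f.norm_apply_le x⟩

/-- A bounded continuous integrable function as an element of `CI d`. -/
def CI.mk (f : Space d → ℂ) (hc : Continuous f) (hi : Integrable f) (hb : ∃ C, ∀ x, ‖f x‖ ≤ C) :
    CI d :=
  ⟨(BoundedContinuousFunction.ofNormedAddCommGroup f hc hb.choose hb.choose_spec, hi.toL1 f),
    hi.coeFn_toL1⟩

theorem CI.norm_le {f : CI d} {C : ℝ} (h1 : ∀ x, ‖f x‖ ≤ C) (h2 : ∫ x, ‖f x‖ ≤ C) : ‖f‖ ≤ C := by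
  refine max_le ((BoundedContinuousFunction.norm_le ((norm_nonneg _).trans (h1 0))).2 h1) ?_
  change ‖f.1.2‖ ≤ C
  rw [L1.norm_eq_integral_norm]
  refine le_trans (le_of_eq (integral_congr_ae ?_)) h2
  filter_upwards [f.coe_ae] with x hx
  rw [hx]

/-- Multiplication by a continuous function bounded by `1`. -/
def mulBdd (c : Space d → ℂ) (hc : Continuous c) (hb : ∀ x, ‖c x‖ ≤ 1) (f : CI d) : CI d :=
  CI.mk (fun x => c x * f x) (hc.mul f.continuous)
    (f.integrable.bdd_mul (c := 1) hc.aestronglyMeasurable (Eventually.of_forall hb))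
    ⟨‖f‖, fun x => by
      rw [norm_mul]
      exact (mul_le_mul (hb x) (f.norm_apply_le x) (norm_nonneg _) zero_le_one).trans_eq
        (one_mul _)⟩

section mulBdd
variable {c : Space d → ℂ} {hc : Continuous c} {hb : ∀ x, ‖c x‖ ≤ 1}

@[simp] theorem mulBdd_apply (f : CI d) (x : Space d) : mulBdd c hc hb f x = c x * f x := rfl

theorem norm_mulBdd_apply_le (f : CI d) (x : Space d) : ‖mulBdd c hc hb f x‖ ≤ ‖f x‖ := by
  rw [mulBdd_apply, norm_mul]
  exact mul_le_of_le_one_left (norm_nonneg _) (hb x)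

theorem norm_mulBdd_le (f : CI d) : ‖mulBdd c hc hb f‖ ≤ ‖f‖ :=
  CI.norm_le (fun x => (norm_mulBdd_apply_le f x).trans (f.norm_apply_le x))
    ((integral_mono (mulBdd c hc hb f).integrable.norm f.integrable.norm
      (norm_mulBdd_apply_le f)).trans f.integral_norm_le)

theorem mulBdd_sub (f g : CI d) : mulBdd c hc hb (f - g) = mulBdd c hc hb f - mulBdd c hc hb g := by
  ext x; simp [mul_sub]

end mulBdd

/-- The weight `exp (-δ |ξ|)`. -/
def decay (δ : ℝ) (ξ : Space d) : ℂ := (Real.exp (-(δ * ‖ξ‖)) : ℝ)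

theorem continuous_decay (δ : ℝ) : Continuous (decay δ : Space d → ℂ) := by
  unfold decay; fun_prop

theorem norm_decay (δ : ℝ) (ξ : Space d) : ‖decay δ ξ‖ = Real.exp (-(δ * ‖ξ‖)) := by
  rw [decay, Complex.norm_real, Real.norm_of_nonneg (Real.exp_pos _).le]

theorem norm_decay_le {δ : ℝ} (hδ : 0 ≤ δ) (ξ : Space d) : ‖decay δ ξ‖ ≤ 1 := by
  rw [norm_decay, Real.exp_le_one_iff]
  have := mul_nonneg hδ (norm_nonneg ξ)
  linarith

/-- Multiplication of an element of `CI d` by the weight `decay δ`. -/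
def damp (δ : ℝ) (hδ : 0 ≤ δ) (f : CI d) : CI d :=
  mulBdd (decay δ) (continuous_decay δ) (norm_decay_le hδ) f

@[simp] theorem damp_apply (δ : ℝ) (hδ : 0 ≤ δ) (f : CI d) (x : Space d) :
    damp δ hδ f x = decay δ x * f x := rfl

theorem norm_damp_le (δ : ℝ) (hδ : 0 ≤ δ) (f : CI d) : ‖damp δ hδ f‖ ≤ ‖f‖ := norm_mulBdd_le f

theorem damp_sub (δ : ℝ) (hδ : 0 ≤ δ) (f g : CI d) :
    damp δ hδ (f - g) = damp δ hδ f - damp δ hδ g := mulBdd_sub f g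

/-- The convolution of two elements of `CI d`. -/
def conv (f g : CI d) : Space d → ℂ := (f : Space d → ℂ) ⋆[ContinuousLinearMap.mul ℂ ℂ, volume] g

theorem conv_apply (f g : CI d) (x : Space d) : conv f g x = ∫ t, f t * g (x - t) := rfl

theorem CI.integrable_mul_shift (f g : CI d) (x : Space d) :
    Integrable (fun t => f t * g (x - t)) :=
  f.integrable.mul_bdd (c := ‖g‖) (g.continuous.comp (by fun_prop)).aestronglyMeasurable
    (Eventually.of_forall fun t => g.norm_apply_le _)

theorem conv_sub_left (f g h : CI d) (x : Space d) :
    conv (f - g) h x = conv f h x - conv g h x := by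
  simp only [conv_apply, CI.sub_apply, sub_mul]
  exact integral_sub (f.integrable_mul_shift h x) (g.integrable_mul_shift h x)

theorem conv_sub_right (f g h : CI d) (x : Space d) :
    conv f (g - h) x = conv f g x - conv f h x := by
  simp only [conv_apply, CI.sub_apply, mul_sub]
  exact integral_sub (f.integrable_mul_shift g x) (f.integrable_mul_shift h x)

theorem continuous_conv (f g : CI d) : Continuous (conv f g) :=
  g.bddAbove.continuous_convolution_right_of_integrable _ f.integrable g.continuous

/-- The weight `exp (δ |ξ|)` times a convolution of damped functions is dominated by the
convolution of the absolute values. -/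
theorem norm_exp_mul_conv_damp_le {δ : ℝ} (hδ : 0 ≤ δ) (f g : CI d) (x : Space d) :
    ‖decay (-δ) x * conv (damp δ hδ f) (damp δ hδ g) x‖ ≤ ∫ t, ‖f t‖ * ‖g (x - t)‖ := by
  rw [conv_apply, ← integral_const_mul]
  refine norm_integral_le_of_norm_le ?_ (Eventually.of_forall fun t => ?_)
  · simpa using (f.integrable_mul_shift g x).norm
  · simp only [damp_apply, norm_mul, norm_decay]
    -- The triangle inequality makes `e^{δ|x|}` submultiplicative, so the weight costs nothing.
    have h : Real.exp (-(-δ * ‖x‖)) * (Real.exp (-(δ * ‖t‖)) * Real.exp (-(δ * ‖x - t‖))) ≤ 1 := by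
      rw [← Real.exp_add, ← Real.exp_add, Real.exp_le_one_iff]
      have h1 : ‖x‖ ≤ ‖t‖ + ‖x - t‖ := by simpa using norm_add_le t (x - t)
      nlinarith
    calc _ = (Real.exp (-(-δ * ‖x‖)) * (Real.exp (-(δ * ‖t‖)) * Real.exp (-(δ * ‖x - t‖))))
          * (‖f t‖ * ‖g (x - t)‖) := by ring
      _ ≤ _ := mul_le_of_le_one_left (by positivity) h

theorem integral_norm_mul_shift_le (f g : CI d) (x : Space d) :
    ∫ t, ‖f t‖ * ‖g (x - t)‖ ≤ ‖f‖ * ‖g‖ := by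
  calc ∫ t, ‖f t‖ * ‖g (x - t)‖ ≤ ∫ t, ‖f t‖ * ‖g‖ := by
        refine integral_mono (by simpa using (f.integrable_mul_shift g x).norm)
          (f.integrable.norm.mul_const _) fun t => ?_
        exact mul_le_mul_of_nonneg_left (g.norm_apply_le _) (norm_nonneg _)
    _ = (∫ t, ‖f t‖) * ‖g‖ := integral_mul_const _ _
    _ ≤ _ := mul_le_mul_of_nonneg_right f.integral_norm_le (norm_nonneg _)

/-- The product of `CI d` that becomes the convolution after damping. -/
def wmul (δ : ℝ) (hδ : 0 ≤ δ) (f g : CI d) : CI d :=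
  have hn : Integrable fun x => ∫ t, ‖f t‖ * ‖g (x - t)‖ :=
    f.integrable.norm.integrable_convolution (ContinuousLinearMap.mul ℝ ℝ) g.integrable.norm
  have hc : Continuous fun x => decay (-δ) x * conv (damp δ hδ f) (damp δ hδ g) x :=
    (continuous_decay _).mul (continuous_conv _ _)
  CI.mk (fun x => decay (-δ) x * conv (damp δ hδ f) (damp δ hδ g) x) hc
    (hn.mono' hc.aestronglyMeasurable (Eventually.of_forall (norm_exp_mul_conv_damp_le hδ f g)))
    ⟨_, fun x => (norm_exp_mul_conv_damp_le hδ f g x).trans (integral_norm_mul_shift_le f g x)⟩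

section wmul
variable {δ : ℝ} {hδ : 0 ≤ δ}

theorem wmul_apply (f g : CI d) (x : Space d) :
    wmul δ hδ f g x = decay (-δ) x * conv (damp δ hδ f) (damp δ hδ g) x := rfl

/-- The supremum is bounded by `L¹` times `L^∞` and the integral by `L¹` times `L¹`. The constant is
1, whatever `δ` is. -/
theorem norm_wmul_le (f g : CI d) : ‖wmul δ hδ f g‖ ≤ ‖f‖ * ‖g‖ := by
  have hn : Integrable fun x => ∫ t, ‖f t‖ * ‖g (x - t)‖ :=
    f.integrable.norm.integrable_convolution (ContinuousLinearMap.mul ℝ ℝ) g.integrable.norm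
  refine CI.norm_le
    (fun x => (norm_exp_mul_conv_damp_le hδ f g x).trans (integral_norm_mul_shift_le f g x)) ?_
  calc ∫ x, ‖wmul δ hδ f g x‖ ≤ ∫ x, ∫ t, ‖f t‖ * ‖g (x - t)‖ :=
        integral_mono (wmul δ hδ f g).integrable.norm hn (norm_exp_mul_conv_damp_le hδ f g)
    _ = (∫ t, ‖f t‖) * ∫ x, ‖g x‖ :=
        integral_convolution (ContinuousLinearMap.mul ℝ ℝ) f.integrable.norm g.integrable.norm
    _ ≤ _ := mul_le_mul f.integral_norm_le g.integral_norm_le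
        (integral_nonneg fun _ => norm_nonneg _) (norm_nonneg _)

theorem wmul_sub_left (f g h : CI d) :
    wmul δ hδ (f - g) h = wmul δ hδ f h - wmul δ hδ g h := by
  ext x
  simp only [wmul_apply, CI.sub_apply, damp_sub, conv_sub_left, mul_sub]

theorem wmul_sub_right (f g h : CI d) :
    wmul δ hδ f (g - h) = wmul δ hδ f g - wmul δ hδ f h := by
  ext x
  simp only [wmul_apply, CI.sub_apply, damp_sub, conv_sub_right, mul_sub]

theorem damp_wmul_apply (f g : CI d) (x : Space d) :
    damp δ hδ (wmul δ hδ f g) x = conv (damp δ hδ f) (damp δ hδ g) x := by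
  rw [damp_apply, wmul_apply, ← mul_assoc, decay, decay, ← Complex.ofReal_mul, ← Real.exp_add]
  simp

end wmul

/-! ### From weighted Fourier transforms to functions and distributions. -/

/-- The class in `L¹` of an element of `CI d`. -/
def CI.toL1 : CI d →L[ℝ] WienerAlgebra d :=
  (ContinuousLinearMap.snd ℝ (Space d →ᵇ ℂ) (WienerAlgebra d)).comp (ciSubmodule d).subtypeL

/-- Damping as a continuous linear map. -/
def dampCLM (δ : ℝ) (hδ : 0 ≤ δ) : CI d →L[ℝ] CI d :=
  LinearMap.mkContinuous
    { toFun := damp δ hδ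
      map_add' := fun f g => by ext x; simp [mul_add]
      map_smul' := fun c f => by ext x; simp [mul_left_comm] } 1 fun f => by
    rw [one_mul]
    exact norm_damp_le δ hδ f

/-- The element of the Wiener algebra with Fourier transform `decay δ * f`. -/
def toWiener (δ : ℝ) (hδ : 0 ≤ δ) : CI d →L[ℝ] WienerAlgebra d := CI.toL1.comp (dampCLM δ hδ)

theorem toWiener_ae (δ : ℝ) (hδ : 0 ≤ δ) (f : CI d) :
    (toWiener δ hδ f : Space d → ℂ) =ᵐ[volume] damp δ hδ f := (damp δ hδ f).coe_ae

theorem norm_toWiener_le (δ : ℝ) (hδ : 0 ≤ δ) (f : CI d) : ‖toWiener δ hδ f‖ ≤ ‖f‖ :=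
  (norm_snd_le (damp δ hδ f).1).trans (norm_damp_le δ hδ f)

theorem fn_toWiener_apply (δ : ℝ) (hδ : 0 ≤ δ) (f : CI d) (x : Space d) :
    fn (toWiener δ hδ f) x = 𝓕⁻ (damp δ hδ f : Space d → ℂ) x := by
  change 𝓕⁻ (toWiener δ hδ f : Space d → ℂ) x = _
  rw [Real.fourierInv_eq, Real.fourierInv_eq]
  exact integral_congr_ae (by filter_upwards [toWiener_ae δ hδ f] with ξ h; rw [h])

/-- Damping turns `wmul` into convolution, which the inverse Fourier transform turns into the
pointwise product. This is what identifies `iterMul` with the nonlinearity `u^k`. -/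
theorem fn_toWiener_wmul (δ : ℝ) (hδ : 0 ≤ δ) (f g : CI d) :
    fn (toWiener δ hδ (wmul δ hδ f g)) = fn (toWiener δ hδ f) * fn (toWiener δ hδ g) := by
  ext x
  rw [BoundedContinuousFunction.mul_apply, fn_toWiener_apply, fn_toWiener_apply,
    fn_toWiener_apply, Real.fourierInv_eq_fourier_neg, Real.fourierInv_eq_fourier_neg,
    Real.fourierInv_eq_fourier_neg]
  rw [← Real.fourier_mul_convolution_eq (damp δ hδ f).integrable (damp δ hδ g).integrable]
  exact congrArg (fun h : Space d → ℂ => 𝓕 h (-x)) (funext fun ξ => damp_wmul_apply f g ξ)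

theorem fn_toWiener_iterMul (δ : ℝ) (hδ : 0 ≤ δ) (n : ℕ) (f : CI d) :
    fn (toWiener δ hδ (iterMul (wmul δ hδ) n f)) = fn (toWiener δ hδ f) ^ (n + 1) := by
  induction n with
  | zero => simp [iterMul]
  | succ n ih => rw [iterMul, fn_toWiener_wmul, ih, pow_succ' _ (n + 1)]

theorem norm_fn_apply_le (g : WienerAlgebra d) (x : Space d) : ‖fn g x‖ ≤ ‖g‖ := by
  rw [L1.norm_eq_integral_norm]
  change ‖𝓕⁻ (g : Space d → ℂ) x‖ ≤ _
  rw [Real.fourierInv_eq]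
  refine (norm_integral_le_integral_norm _).trans (le_of_eq ?_)
  simp

/-- Fubini: the inverse Fourier integral, with kernel given by the form `-⟨·, ·⟩`, is its own
transpose. -/
theorem toDist_fn (g : WienerAlgebra d) : toDist (fn g) = 𝓕⁻ (g : 𝓢'(Space d, ℂ)) := by
  ext φ
  rw [toDist_apply, TemperedDistribution.fourierInv_apply, Lp.toTemperedDistribution_apply]
  have h := VectorFourier.integral_fourierIntegral_smul_eq_flip (e := Real.fourierChar)
    (μ := (volume : Measure (Space d))) (ν := (volume : Measure (Space d)))
    (L := -innerₗ (Space d)) (f := φ) (g := (g : Space d → ℂ)) Real.continuous_fourierChar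
    (by simp only [LinearMap.neg_apply, innerₗ_apply_apply]; fun_prop) φ.integrable
    (L1.integrable_coeFn g)
  have h1 : ∀ f : Space d → ℂ, VectorFourier.fourierIntegral Real.fourierChar volume
      (-innerₗ (Space d)) f = 𝓕⁻ f := fun f => by
    ext x; rw [Real.fourierInv_eq]; simp [VectorFourier.fourierIntegral]
  have h2 : ∀ f : Space d → ℂ, VectorFourier.fourierIntegral Real.fourierChar volume
      (-innerₗ (Space d)).flip f = 𝓕⁻ f := fun f => by
    ext x; rw [Real.fourierInv_eq]; simp [VectorFourier.fourierIntegral, real_inner_comm]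
  rw [h1, h2] at h
  rw [SchwartzMap.fourierInv_coe]
  exact h.symm

/-- The map sending an element of the Wiener algebra to the corresponding distribution. -/
def distCLM (d : ℕ) : WienerAlgebra d →L[ℂ] 𝓢'(Space d, ℂ) :=
  (fourierInvCLM ℂ 𝓢'(Space d, ℂ)).comp (Lp.toTemperedDistributionCLM ℂ volume 1)

theorem distCLM_apply (g : WienerAlgebra d) : distCLM d g = toDist (fn g) := (toDist_fn g).symm

theorem toDist_fn_add (f g : WienerAlgebra d) :
    toDist (fn (f + g)) = toDist (fn f) + toDist (fn g) := by
  simp only [← distCLM_apply, map_add]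

/-! ### Sobolev norms on the Fourier side. -/

/-- The symbol `(1 + |ξ|²)^(s/2)`. -/
def bracket (s : ℝ) (ξ : Space d) : ℂ := ((1 + ‖ξ‖ ^ 2) ^ (s / 2) : ℝ)

theorem hasTemperateGrowth_bracket (s : ℝ) :
    Function.HasTemperateGrowth (bracket s : Space d → ℂ) := by
  unfold bracket; fun_prop

theorem continuous_bracket (s : ℝ) : Continuous (bracket s : Space d → ℂ) :=
  (hasTemperateGrowth_bracket s).1.continuous

theorem norm_bracket (s : ℝ) (ξ : Space d) : ‖bracket s ξ‖ = (1 + ‖ξ‖ ^ 2) ^ (s / 2) := by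
  rw [bracket, Complex.norm_real, Real.norm_of_nonneg (by positivity)]

theorem besselPotential_toDist_fn {s : ℝ} {f : WienerAlgebra d}
    {h : Lp ℂ 2 (volume : Measure (Space d))} (hf : (h : Space d → ℂ) =ᵐ[volume] bracket s * (f : Space d → ℂ)) :
    besselPotential (Space d) ℂ s (toDist (fn f))
      = ((𝓕⁻ h : Lp ℂ 2 (volume : Measure (Space d))) : 𝓢'(Space d, ℂ)) := by
  rw [← Lp.fourierInv_toTemperedDistribution_eq, besselPotential,
    TemperedDistribution.fourierMultiplierCLM_apply, toDist_fn, fourier_fourierInv_eq]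
  congr 1
  ext φ
  rw [smulLeftCLM_apply_apply, Lp.toTemperedDistribution_apply, Lp.toTemperedDistribution_apply]
  refine integral_congr_ae ?_
  filter_upwards [hf] with x hx
  have hb : Function.HasTemperateGrowth fun ξ : Space d => (((1 + ‖ξ‖ ^ 2) ^ (s / 2) : ℝ) : ℂ) :=
    hasTemperateGrowth_bracket s
  rw [hx, SchwartzMap.smulLeftCLM_apply_apply hb]
  simp only [smul_eq_mul, Pi.mul_apply, bracket]
  ring

theorem sobolevNorm_toDist_fn {s : ℝ} {f : WienerAlgebra d}
    {h : Lp ℂ 2 (volume : Measure (Space d))} (hf : (h : Space d → ℂ) =ᵐ[volume] bracket s * (f : Space d → ℂ)) :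
    sobolevNorm s (toDist (fn f)) = ‖h‖ₑ := by
  rw [sobolevNorm_eq (besselPotential_toDist_fn hf), ← ofReal_norm, ← ofReal_norm,
    ← Lp.norm_fourier_eq, fourier_fourierInv_eq]

theorem memSobolev_toDist_fn {s : ℝ} {f : WienerAlgebra d} (hf : MemLp (bracket s * (f : Space d → ℂ)) 2 volume) :
    MemSobolev s 2 (toDist (fn f)) :=
  ⟨_, besselPotential_toDist_fn hf.coeFn_toLp⟩

theorem sobolevNorm_toDist_fn_eq_eLpNorm {s : ℝ} {f : WienerAlgebra d}
    (hf : MemLp (bracket s * (f : Space d → ℂ)) 2 volume) :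
    sobolevNorm s (toDist (fn f)) = eLpNorm (bracket s * (f : Space d → ℂ)) 2 volume := by
  rw [sobolevNorm_toDist_fn hf.coeFn_toLp, Lp.enorm_toLp]

theorem sobolevNorm_add_le (s : ℝ) (f g : 𝓢'(Space d, ℂ)) :
    sobolevNorm s (f + g) ≤ sobolevNorm s f + sobolevNorm s g := by
  -- The slack `ε` is discarded; what matters is that the right-hand side may be taken finite.
  refine ENNReal.le_of_forall_pos_le_add fun ε hε hfin => ?_
  obtain ⟨f', hf'⟩ := sobolevNorm_lt_top_iff.1 (ENNReal.add_lt_top.1 hfin).1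
  obtain ⟨g', hg'⟩ := sobolevNorm_lt_top_iff.1 (ENNReal.add_lt_top.1 hfin).2
  have h : besselPotential (Space d) ℂ s (f + g)
      = ((f' + g' : Lp ℂ 2 (volume : Measure (Space d))) : 𝓢'(Space d, ℂ)) := by
    rw [map_add, hf', hg']
    exact (map_add (Lp.toTemperedDistributionCLM ℂ volume 2) f' g').symm
  rw [sobolevNorm_eq hf', sobolevNorm_eq hg', sobolevNorm_eq h]
  exact (enorm_add_le _ _).trans le_self_add

/-- Functions with continuous compactly supported Fourier transform are dense in `H^s`. -/
theorem exists_sobolevNorm_sub_le {s : ℝ} {u : 𝓢'(Space d, ℂ)} (hu : MemSobolev s 2 u)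
    {ε : ℝ≥0∞} (hε : ε ≠ 0) :
    ∃ a : Space d → ℂ, Continuous a ∧ HasCompactSupport a ∧
      ∀ f : WienerAlgebra d, (f : Space d → ℂ) =ᵐ[volume] a →
        sobolevNorm s (toDist (fn f) - u) ≤ ε := by
  obtain ⟨g, hg⟩ := hu
  obtain ⟨h, hsupp, hle, hcont, hmem⟩ :=
    (Lp.memLp (𝓕 g)).exists_hasCompactSupport_eLpNorm_sub_le (by norm_num) hε
  -- `𝓕 g` is `⟨ξ⟩^s û` and `h` approximates it in `L²`; dividing by the symbol keeps the support.
  refine ⟨bracket (-s) * h, (continuous_bracket _).mul hcont, hsupp.mul_left, fun f hf => ?_⟩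
  have h1 : (hmem.toLp h : Space d → ℂ) =ᵐ[volume] bracket s * (f : Space d → ℂ) := by
    filter_upwards [hf, hmem.coeFn_toLp] with x hx hx'
    rw [hx', Pi.mul_apply, hx, Pi.mul_apply, ← mul_assoc, bracket, bracket, ← Complex.ofReal_mul,
      ← Real.rpow_add (by positivity)]
    simp [neg_div]
  have h2 : besselPotential (Space d) ℂ s (toDist (fn f) - u)
      = ((𝓕⁻ (hmem.toLp h - 𝓕 g) : Lp ℂ 2 (volume : Measure (Space d))) : 𝓢'(Space d, ℂ)) := by
    rw [map_sub, hg, besselPotential_toDist_fn h1]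
    have : (𝓕⁻ (hmem.toLp h - 𝓕 g) : Lp ℂ 2 (volume : Measure (Space d)))
        = 𝓕⁻ (hmem.toLp h) - g := by
      refine (map_sub (Lp.fourierTransformₗᵢ (Space d) ℂ).symm _ _).trans ?_
      exact congrArg (_ - ·) ((Lp.fourierTransformₗᵢ (Space d) ℂ).symm_apply_apply g)
    rw [this]
    exact (map_sub (Lp.toTemperedDistributionCLM ℂ volume 2) _ _).symm
  rw [sobolevNorm_eq h2, ← ofReal_norm, ← Lp.norm_fourier_eq, fourier_fourierInv_eq, norm_sub_rev,
    ofReal_norm, Lp.enorm_def]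
  refine le_trans (le_of_eq (eLpNorm_congr_ae ?_)) hle
  filter_upwards [Lp.coeFn_sub (𝓕 g) (hmem.toLp h), hmem.coeFn_toLp] with x hx hx'
  rw [hx, Pi.sub_apply, Pi.sub_apply, hx']

/-- Testing against a fixed Schwartz function is bounded on `H^σ`. -/
theorem exists_enorm_apply_le_mul_sobolevNorm (σ : ℝ) (θ : 𝓢(Space d, ℂ)) :
    ∃ C : ℝ, 0 < C ∧ ∀ f : 𝓢'(Space d, ℂ), ‖f θ‖ₑ ≤ ENNReal.ofReal C * sobolevNorm σ f := by
  -- For `f = ⟨D⟩^{-σ} g` with `g` in `L²`, `f θ` is a continuous functional of `g`. The constant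
  -- `‖Λ‖ + 1` is positive, so that the bound is also meaningful off `H^σ`, where the norm is
  -- infinite.
  let Λ : Lp ℂ 2 (volume : Measure (Space d)) →L[ℂ] ℂ :=
    (PointwiseConvergenceCLM.evalCLM (RingHom.id ℂ) ℂ θ).comp
      ((besselPotential (Space d) ℂ (-σ)).comp (Lp.toTemperedDistributionCLM ℂ volume 2))
  refine ⟨‖Λ‖ + 1, by positivity, fun f => ?_⟩
  by_cases hf : MemSobolev σ 2 f
  · obtain ⟨g, hg⟩ := hf
    have h : f = besselPotential (Space d) ℂ (-σ) (g : 𝓢'(Space d, ℂ)) := by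
      rw [← hg, besselPotential_besselPotential_apply]; simp
    have h1 : f θ = Λ g := by rw [h]; rfl
    rw [sobolevNorm_eq hg, h1, ← ofReal_norm, ← ofReal_norm, ← ENNReal.ofReal_mul (by positivity)]
    refine ENNReal.ofReal_le_ofReal ((Λ.le_opNorm g).trans ?_)
    gcongr
    linarith
  · have : sobolevNorm σ f = ∞ := by
      rwa [← not_lt_top_iff, sobolevNorm_lt_top_iff]
    rw [this, ENNReal.mul_top (by simp; positivity)]
    exact le_top

/-- Frequency translates tend to `0` in `H^s` for `s < 0`. -/
theorem tendsto_sobolevNorm_translate {s : ℝ} (hs : s < 0) {q : Space d → ℂ} (hq : Continuous q)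
    (hqs : HasCompactSupport q) {c : ℕ → Space d} (hc : Tendsto (fun n => ‖c n‖) atTop atTop)
    {f : ℕ → WienerAlgebra d} (hf : ∀ n, (f n : Space d → ℂ) =ᵐ[volume] fun ξ => q (ξ - c n)) :
    Tendsto (fun n => sobolevNorm s (toDist (fn (f n)))) atTop (𝓝 0) := by
  obtain ⟨r, hr⟩ := hqs.isCompact.isBounded.subset_closedBall (0 : Space d)
  have hq2 : MemLp q 2 volume := hq.memLp_of_hasCompactSupport hqs
  have hmem : ∀ n, MemLp (fun ξ => bracket s ξ * q (ξ - c n)) 2 volume := fun n =>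
    Continuous.memLp_of_hasCompactSupport
      ((continuous_bracket s).mul (hq.comp (by fun_prop)))
      (HasCompactSupport.mul_left (hqs.comp_homeomorph (Homeomorph.subRight (c n))))
  have hae : ∀ n, bracket s * (f n : Space d → ℂ) =ᵐ[volume] fun ξ => bracket s ξ * q (ξ - c n) :=
    fun n => by filter_upwards [hf n] with ξ hξ; simp [hξ]
  -- On the support of the translate `|ξ| ≥ ‖c n‖ - r`, so for `s < 0` the symbol is at most this
  -- factor once `‖c n‖ ≥ r`.
  have hlim : Tendsto (fun n => ENNReal.ofReal ((1 + (‖c n‖ - r) ^ 2) ^ (s / 2))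
      * eLpNorm q 2 volume) atTop (𝓝 0) := by
    rw [← zero_mul (eLpNorm q 2 volume)]
    refine ENNReal.Tendsto.mul_const ?_ (Or.inr hq2.2.ne)
    rw [← ENNReal.ofReal_zero]
    refine ENNReal.tendsto_ofReal ?_
    have h1 : Tendsto (fun n => 1 + (‖c n‖ - r) ^ 2) atTop atTop :=
      tendsto_atTop_add_const_left _ _ ((tendsto_pow_atTop two_ne_zero).comp
        (tendsto_atTop_add_const_right _ (-r) hc))
    have h2 := (tendsto_rpow_neg_atTop (y := -(s / 2)) (by linarith)).comp h1
    simpa using! h2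
  refine tendsto_of_tendsto_of_tendsto_of_le_of_le' tendsto_const_nhds hlim
    (Eventually.of_forall fun _ => zero_le) ?_
  filter_upwards [hc.eventually_ge_atTop r] with n hn
  rw [sobolevNorm_toDist_fn_eq_eLpNorm ((memLp_congr_ae (hae n)).2 (hmem n)),
    eLpNorm_congr_ae (hae n),
    ← eLpNorm_comp_measurePreserving (hmem n).1 (measurePreserving_add_right volume (c n))]
  have h3 : ENNReal.ofReal ((1 + (‖c n‖ - r) ^ 2) ^ (s / 2))
      = ‖(((1 + (‖c n‖ - r) ^ 2) ^ (s / 2) : ℝ) : ℂ)‖ₑ := by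
    rw [← ofReal_norm, Complex.norm_real, Real.norm_of_nonneg (by positivity)]
  rw [h3, ← eLpNorm_const_smul]
  refine eLpNorm_mono fun ξ => ?_
  simp only [Function.comp_apply, add_sub_cancel_right, Pi.smul_apply, smul_eq_mul, norm_mul]
  by_cases hξ : q ξ = 0
  · simp [hξ]
  · have hmem : ‖ξ‖ ≤ r := by simpa using hr (subset_tsupport q hξ)
    gcongr
    rw [norm_bracket, Complex.norm_real, Real.norm_of_nonneg (by positivity)]
    refine Real.rpow_le_rpow_of_nonpos (by positivity) ?_ (by linarith)
    gcongr
    have := norm_sub_norm_le (c n) (-ξ)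
    rw [norm_neg, sub_neg_eq_add, add_comm] at this
    linarith

/-! ### The equation and the Laplacian on the Fourier side. -/

/-- The symbol `4π²|ξ|²` of `-Δ`. -/
def lap (ξ : Space d) : ℂ := ((2 * Real.pi) ^ 2 * ‖ξ‖ ^ 2 : ℝ)

theorem hasTemperateGrowth_lap : Function.HasTemperateGrowth (lap : Space d → ℂ) := by
  unfold lap; fun_prop

theorem laplacian_toDist_fn (g : WienerAlgebra d) :
    Δ (toDist (fn g)) = -𝓕⁻ (smulLeftCLM ℂ lap (g : 𝓢'(Space d, ℂ))) := by
  have h : (lap : Space d → ℂ)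
      = ((2 * Real.pi) ^ 2 : ℂ) • fun ξ : Space d => ((‖ξ‖ ^ 2 : ℝ) : ℂ) := by
    ext ξ; simp [lap]
  rw [TemperedDistribution.laplacian_eq_fourierMultiplierCLM,
    TemperedDistribution.fourierMultiplierCLM_apply, toDist_fn, fourier_fourierInv_eq, h,
    smulLeftCLM_smul (by fun_prop)]
  ext φ
  simp only [smul_apply, neg_apply,
    TemperedDistribution.fourierInv_apply, neg_smul]
  simp [← Complex.coe_smul]

theorem smulLeftCLM_toTemperedDistribution_congr {g₁ g₂ : Space d → ℂ}
    (h₁ : g₁.HasTemperateGrowth) (h₂ : g₂.HasTemperateGrowth) {f₁ f₂ : WienerAlgebra d}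
    (h : g₁ * (f₁ : Space d → ℂ) =ᵐ[volume] g₂ * (f₂ : Space d → ℂ)) :
    smulLeftCLM ℂ g₁ (f₁ : 𝓢'(Space d, ℂ)) = smulLeftCLM ℂ g₂ (f₂ : 𝓢'(Space d, ℂ)) := by
  ext φ
  rw [smulLeftCLM_apply_apply, smulLeftCLM_apply_apply, Lp.toTemperedDistribution_apply,
    Lp.toTemperedDistribution_apply]
  refine integral_congr_ae ?_
  filter_upwards [h] with x hx
  rw [SchwartzMap.smulLeftCLM_apply_apply h₁, SchwartzMap.smulLeftCLM_apply_apply h₂]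
  simp only [smul_eq_mul, Pi.mul_apply] at hx ⊢
  linear_combination φ x * hx

/-- The symbol `4π²|ξ|² / (1 + 4π²|ξ|²)` of `-(1 - Δ)⁻¹ Δ`. -/
def symb (ξ : Space d) : ℂ :=
  ((2 * Real.pi) ^ 2 * ‖ξ‖ ^ 2 / (1 + (2 * Real.pi) ^ 2 * ‖ξ‖ ^ 2) : ℝ)

theorem continuous_symb : Continuous (symb : Space d → ℂ) := by
  unfold symb
  refine Complex.continuous_ofReal.comp (Continuous.div (by fun_prop) (by fun_prop) fun ξ => ?_)
  positivity

theorem norm_symb_le (ξ : Space d) : ‖symb ξ‖ ≤ 1 := by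
  rw [symb, Complex.norm_real, Real.norm_of_nonneg (by positivity), div_le_one (by positivity)]
  linarith

theorem one_add_lap_mul_symb (ξ : Space d) : (1 + lap ξ) * symb ξ = lap ξ := by
  rw [lap, symb, ← Complex.ofReal_one, ← Complex.ofReal_add, ← Complex.ofReal_mul]
  congr 1
  field_simp

/-- The equation on the Fourier side. -/
theorem equation_of_ae_eq {f p a : WienerAlgebra d} {k : ℕ} (hp : fn p = fn f ^ k)
    (h : (a : Space d → ℂ) =ᵐ[volume] fun ξ => -(symb ξ * (f ξ + p ξ))) :
    toDist (fn a) - Δ (toDist (fn f)) - Δ (toDist (fn a)) = Δ (toDist (fn f ^ k)) := by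
  have h1 : Function.HasTemperateGrowth ((fun _ => 1) + lap : Space d → ℂ) :=
    (by fun_prop : Function.HasTemperateGrowth (fun _ : Space d => (1 : ℂ))).add
      hasTemperateGrowth_lap
  -- This is `(1 - Δ) u_tt = Δ (u + u^k)` before the inverse transform.
  have key : smulLeftCLM ℂ ((fun _ => 1) + lap) (a : 𝓢'(Space d, ℂ))
      = smulLeftCLM ℂ (-lap) ((f + p : WienerAlgebra d) : 𝓢'(Space d, ℂ)) := by
    refine smulLeftCLM_toTemperedDistribution_congr h1 hasTemperateGrowth_lap.neg ?_
    filter_upwards [h, Lp.coeFn_add f p] with ξ h1 h2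
    simp only [Pi.mul_apply, h1, h2, Pi.add_apply, Pi.neg_apply]
    linear_combination (-(f ξ + p ξ)) * one_add_lap_mul_symb ξ
  have hadd : ((f + p : WienerAlgebra d) : 𝓢'(Space d, ℂ))
      = (f : 𝓢'(Space d, ℂ)) + (p : 𝓢'(Space d, ℂ)) :=
    map_add (Lp.toTemperedDistributionCLM ℂ volume 1) f p
  rw [smulLeftCLM_add (by fun_prop) hasTemperateGrowth_lap, smulLeftCLM_neg hasTemperateGrowth_lap,
    hadd, add_apply, neg_apply, map_add,
    smulLeftCLM_const, one_smul] at key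
  rw [← hp, laplacian_toDist_fn, laplacian_toDist_fn, laplacian_toDist_fn, toDist_fn,
    ← sub_eq_zero, sub_neg_eq_add, sub_neg_eq_add, sub_neg_eq_add, ← FourierTransform.fourierInv_add,
    ← FourierTransform.fourierInv_add, ← FourierTransform.fourierInv_add]
  rw [← sub_eq_zero] at key
  have : (a : 𝓢'(Space d, ℂ)) + smulLeftCLM ℂ lap (f : 𝓢'(Space d, ℂ))
      + smulLeftCLM ℂ lap (a : 𝓢'(Space d, ℂ)) + smulLeftCLM ℂ lap (p : 𝓢'(Space d, ℂ)) = 0 := by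
    rw [← key]; abel
  rw [this]
  exact map_zero (fourierInvCLM ℂ 𝓢'(Space d, ℂ))

/-- If `Δ` of an element of the Wiener algebra vanishes, then so does the element. -/
theorem eq_zero_of_laplacian_eq_zero (hd : 1 ≤ d) {p : WienerAlgebra d}
    (h : Δ (toDist (fn p)) = 0) : p = 0 := by
  -- In positive dimension the zero set `{0}` of the symbol is a null set.
  have : Nonempty (Fin d) := ⟨⟨0, hd⟩⟩
  rw [laplacian_toDist_fn, neg_eq_zero] at h
  have h0 : smulLeftCLM ℂ lap (p : 𝓢'(Space d, ℂ)) = 0 := by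
    have h' := congrArg (𝓕 : 𝓢'(Space d, ℂ) → 𝓢'(Space d, ℂ)) h
    rw [fourier_fourierInv_eq] at h'
    exact h'.trans (map_zero (fourierCLM ℂ 𝓢'(Space d, ℂ)))
  have hloc : LocallyIntegrable (fun ξ => lap ξ * p ξ) (volume : Measure (Space d)) := by
    have hp : LocallyIntegrable (p : Space d → ℂ) volume :=
      (L1.integrable_coeFn p).locallyIntegrable
    rw [← locallyIntegrableOn_univ] at hp ⊢
    exact hp.continuousOn_mul hasTemperateGrowth_lap.1.continuous.continuousOn
      isOpen_univ.isLocallyClosed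
  have hae : ∀ᵐ ξ : Space d, lap ξ * p ξ = 0 := by
    refine ae_eq_zero_of_integral_contDiff_smul_eq_zero hloc fun g g_smooth g_cpt => ?_
    have hg₁ : HasCompactSupport (Complex.ofRealCLM ∘ g) := g_cpt.comp_left rfl
    have hg₂ : ContDiff ℝ ((⊤ : ℕ∞) : WithTop ℕ∞) (Complex.ofRealCLM ∘ g) := by fun_prop
    have := congrArg (fun T : 𝓢'(Space d, ℂ) => T (hg₁.toSchwartzMap hg₂)) h0
    simp only [smulLeftCLM_apply_apply, Lp.toTemperedDistribution_apply,
      SchwartzMap.smulLeftCLM_apply_apply hasTemperateGrowth_lap] at this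
    refine Eq.trans ?_ this
    refine integral_congr_ae (Eventually.of_forall fun ξ => ?_)
    simp
    ring
  rw [Lp.eq_zero_iff_ae_eq_zero]
  have hne : ∀ᵐ ξ : Space d, ξ ≠ 0 := Measure.ae_ne volume 0
  filter_upwards [hae, hne] with ξ h1 h2
  have h3 : lap ξ ≠ 0 := by
    rw [lap, Complex.ofReal_ne_zero]
    have := norm_pos_iff.2 h2
    positivity
  simpa [h3] using h1

/-! ### Weighted norms of compactly supported data, and smoothness of damped functions. -/

/-- The element of `CI d` whose damping is a given compactly supported function. -/
def undamp (δ : ℝ) (a : Space d → ℂ) (ha : Continuous a) (hs : HasCompactSupport a) : CI d :=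
  have hc : Continuous fun ξ => decay (-δ) ξ * a ξ := (continuous_decay _).mul ha
  CI.mk (fun ξ => decay (-δ) ξ * a ξ) hc (hc.integrable_of_hasCompactSupport hs.mul_left)
    (hs.mul_left.exists_bound_of_continuous hc)

theorem damp_undamp (δ : ℝ) (hδ : 0 ≤ δ) (a : Space d → ℂ) (ha : Continuous a)
    (hs : HasCompactSupport a) (ξ : Space d) : damp δ hδ (undamp δ a ha hs) ξ = a ξ := by
  change decay δ ξ * (decay (-δ) ξ * a ξ) = a ξ
  rw [← mul_assoc, decay, decay, ← Complex.ofReal_mul, ← Real.exp_add]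
  simp

theorem toWiener_undamp (δ : ℝ) (hδ : 0 ≤ δ) (a : Space d → ℂ) (ha : Continuous a)
    (hs : HasCompactSupport a) :
    (toWiener δ hδ (undamp δ a ha hs) : Space d → ℂ) =ᵐ[volume] a := by
  filter_upwards [toWiener_ae δ hδ (undamp δ a ha hs)] with ξ h
  rw [h, damp_undamp]

/-- Only the size of `δ |ξ|` on the support enters, so a support at distance of order `N` is
harmless when `δ` is of order `1 / N`. -/
theorem norm_undamp_le {δ ρ C : ℝ} {a : Space d → ℂ} (ha : Continuous a)
    (hs : HasCompactSupport a) (hC : ∀ ξ, ‖a ξ‖ ≤ C) (hI : ∫ ξ, ‖a ξ‖ ≤ C)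
    (hρ : ∀ ξ, a ξ ≠ 0 → δ * ‖ξ‖ ≤ ρ) : ‖undamp δ a ha hs‖ ≤ Real.exp ρ * C := by
  have h : ∀ ξ, ‖undamp δ a ha hs ξ‖ ≤ Real.exp ρ * ‖a ξ‖ := fun ξ => by
    change ‖decay (-δ) ξ * a ξ‖ ≤ _
    by_cases h0 : a ξ = 0
    · simp [h0]
    · rw [norm_mul, norm_decay]
      gcongr
      simpa using hρ ξ h0
  refine CI.norm_le (fun ξ => (h ξ).trans (by gcongr; exact hC ξ)) ?_
  calc ∫ ξ, ‖undamp δ a ha hs ξ‖ ≤ ∫ ξ, Real.exp ρ * ‖a ξ‖ :=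
        integral_mono (undamp δ a ha hs).integrable.norm
          ((ha.integrable_of_hasCompactSupport hs).norm.const_mul _) h
    _ = Real.exp ρ * ∫ ξ, ‖a ξ‖ := integral_const_mul _ _
    _ ≤ _ := by gcongr

/-- Uniformity in `δ` is the point: `δ` is fixed only after the constants built from this bound. -/
theorem exists_norm_undamp_le {a : Space d → ℂ} (ha : Continuous a) (hs : HasCompactSupport a) :
    ∃ C, ∀ δ ≤ 1, ‖undamp δ a ha hs‖ ≤ C := by
  obtain ⟨r, hr⟩ := hs.isCompact.isBounded.subset_closedBall (0 : Space d)
  obtain ⟨C, hC⟩ := hs.exists_bound_of_continuous ha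
  refine ⟨Real.exp r * max C (∫ ξ, ‖a ξ‖), fun δ hδ => norm_undamp_le ha hs
    (fun ξ => (hC ξ).trans (le_max_left _ _)) (le_max_right _ _) fun ξ h => ?_⟩
  have : ‖ξ‖ ≤ r := by simpa using hr (subset_tsupport a h)
  exact (mul_le_of_le_one_left (norm_nonneg _) hδ).trans this

/-- Elements of the Wiener algebra with exponentially decaying Fourier transform are in every
`H^σ`. -/
theorem memSobolev_toWiener {δ : ℝ} (hδ : 0 < δ) (σ : ℝ) (f : CI d) :
    MemSobolev σ 2 (toDist (fn (toWiener δ hδ.le f))) := by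
  apply memSobolev_toDist_fn
  have h1 : MemLp (f : Space d → ℂ) 2 volume := by
    refine (memLp_two_iff_integrable_sq_norm f.continuous.aestronglyMeasurable).2 ?_
    simp only [pow_two]
    exact f.integrable.norm.mul_bdd (c := ‖f‖) f.continuous.norm.aestronglyMeasurable
      (Eventually.of_forall fun x => by rw [norm_norm]; exact f.norm_apply_le x)
  -- Exponential decay absorbs any power of `⟨ξ⟩`, leaving `f`, which is in `L²` because it is
  -- bounded and integrable.
  obtain ⟨C, hC⟩ : ∃ C, ∀ ξ : Space d, ‖bracket σ ξ * decay δ ξ‖ ≤ C := by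
    have hlim : Tendsto (fun x : ℝ => (1 + x) ^ |σ| * Real.exp (-δ * x)) atTop (𝓝 0) := by
      have h := (tendsto_rpow_mul_exp_neg_mul_atTop_nhds_zero |σ| δ hδ).comp
        (tendsto_atTop_add_const_left atTop (1 : ℝ) tendsto_id)
      have h2 := h.mul_const (Real.exp δ)
      rw [zero_mul] at h2
      refine h2.congr fun x => ?_
      simp only [Function.comp_apply, id]
      rw [mul_assoc, ← Real.exp_add]
      congr 2; ring
    have hcont : ContinuousOn (fun x : ℝ => (1 + x) ^ |σ| * Real.exp (-δ * x)) (Ici 0) := by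
      refine ContinuousOn.mul ?_ (by fun_prop)
      exact ContinuousOn.rpow_const (by fun_prop) fun x hx => Or.inr (abs_nonneg σ)
    obtain ⟨A, hA⟩ := (hlim.eventually (gt_mem_nhds (zero_lt_one' ℝ))).exists_forall_of_atTop
    obtain ⟨M, hM⟩ := (isCompact_Icc (a := (0 : ℝ)) (b := A)).exists_bound_of_continuousOn
      (hcont.mono fun x hx => hx.1)
    refine ⟨max M 1, fun ξ => ?_⟩
    have hb : ‖bracket σ ξ * decay δ ξ‖ ≤ (1 + ‖ξ‖) ^ |σ| * Real.exp (-δ * ‖ξ‖) := by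
      rw [norm_mul, norm_bracket, norm_decay, neg_mul]
      gcongr
      calc (1 + ‖ξ‖ ^ 2) ^ (σ / 2) ≤ (1 + ‖ξ‖ ^ 2) ^ (|σ| / 2) :=
            Real.rpow_le_rpow_of_exponent_le (by nlinarith [norm_nonneg ξ])
              (by linarith [le_abs_self σ])
        _ ≤ ((1 + ‖ξ‖) ^ 2) ^ (|σ| / 2) := by
            refine Real.rpow_le_rpow (by positivity) (by nlinarith [norm_nonneg ξ]) (by positivity)
        _ = (1 + ‖ξ‖) ^ |σ| := by
            rw [← Real.rpow_natCast, ← Real.rpow_mul (by positivity)]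
            congr 1; push_cast; ring
    refine hb.trans ?_
    rcases le_total A ‖ξ‖ with h | h
    · exact (hA _ h).le.trans (le_max_right _ _)
    · exact (le_abs_self _).trans ((hM _ ⟨norm_nonneg _, h⟩).trans (le_max_left _ _))
  have h2 : MemLp (fun ξ => (bracket σ ξ * decay δ ξ) * f ξ) 2 volume := by
    refine MemLp.of_le_mul (c := C) h1 (((continuous_bracket σ).mul
      (continuous_decay δ)).mul f.continuous).aestronglyMeasurable (Eventually.of_forall fun ξ => ?_)
    rw [norm_mul]
    exact mul_le_mul_of_nonneg_right (hC ξ) (norm_nonneg _)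
  refine (memLp_congr_ae ?_).1 h2
  filter_upwards [toWiener_ae δ hδ.le f] with ξ h
  rw [Pi.mul_apply, h, damp_apply, mul_assoc]

/-! ### The two-bump data and their resonance. -/

theorem exists_bump (d : ℕ) : ∃ q : Space d → ℂ, Continuous q ∧ HasCompactSupport q ∧
    (∀ ξ, q ξ ≠ 0 → ‖ξ‖ ≤ 2) ∧ ∫ ξ, q ξ ≠ 0 := by
  let b : ContDiffBump (0 : Space d) := ⟨1, 2, one_pos, one_lt_two⟩
  have hc : Continuous (b : Space d → ℝ) := b.continuous
  have hs : HasCompactSupport (b : Space d → ℝ) := b.hasCompactSupport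
  refine ⟨fun ξ => (b ξ : ℂ), by fun_prop, hs.comp_left (g := Complex.ofReal) Complex.ofReal_zero,
    fun ξ h => ?_, ?_⟩
  · have h1 : ξ ∈ Function.support b := fun h0 => h (by simp [h0])
    rw [b.support_eq, mem_ball_zero_iff] at h1
    exact h1.le
  · rw [integral_complex_ofReal, Complex.ofReal_ne_zero]
    exact b.integral_pos.ne'

theorem fourierInv_translate (q : Space d → ℂ) (c x : Space d) :
    𝓕⁻ (fun ξ => q (ξ - c)) x = (Real.fourierChar (inner ℝ c x) : ℂ) * 𝓕⁻ q x := by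
  rw [Real.fourierInv_eq, Real.fourierInv_eq, ← integral_add_right_eq_self _ c,
    ← integral_const_mul]
  refine integral_congr_ae (Eventually.of_forall fun ξ => ?_)
  simp only [add_sub_cancel_right, inner_add_left, AddChar.map_add_eq_mul, Circle.smul_def,
    Circle.coe_mul, smul_eq_mul]
  ring

/-- The Riemann-Lebesgue lemma, applied at `-c N` to match the sign of the phase. -/
theorem tendsto_integral_fourierChar_mul (F : Space d → ℂ) {c : ℕ → Space d}
    (hc : Tendsto (fun N => ‖c N‖) atTop atTop) :
    Tendsto (fun N => ∫ x, (Real.fourierChar (inner ℝ (c N) x) : ℂ) * F x) atTop (𝓝 0) := by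
  have hc' : Tendsto (fun N => -c N) atTop (cocompact (Space d)) := by
    rw [← cobounded_eq_cocompact, ← tendsto_norm_atTop_iff_cobounded]
    simpa using hc
  refine ((tendsto_integral_exp_inner_smul_cocompact F).comp hc').congr fun N => ?_
  simp only [Function.comp_apply]
  refine integral_congr_ae (Eventually.of_forall fun x => ?_)
  simp only [inner_neg_right, neg_neg, Circle.smul_def, smul_eq_mul, real_inner_comm]

/-- Two translates of `q`, at frequencies `N e` and `-n N e`. -/
def twoBumps (q : Space d → ℂ) (e : Space d) (n N : ℕ) (ξ : Space d) : ℂ :=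
  q (ξ - (N : ℝ) • e) + q (ξ - (-(n * N : ℝ)) • e)

theorem continuous_twoBumps {q : Space d → ℂ} (hq : Continuous q) (e : Space d) (n N : ℕ) :
    Continuous (twoBumps q e n N) :=
  (hq.comp (by fun_prop)).add (hq.comp (by fun_prop))

theorem hasCompactSupport_translate {q : Space d → ℂ} (hs : HasCompactSupport q) (c : Space d) :
    HasCompactSupport fun ξ => q (ξ - c) :=
  hs.comp_homeomorph (Homeomorph.subRight c)

theorem hasCompactSupport_twoBumps {q : Space d → ℂ} (hs : HasCompactSupport q) (e : Space d)
    (n N : ℕ) : HasCompactSupport (twoBumps q e n N) :=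
  (hasCompactSupport_translate hs _).add (hasCompactSupport_translate hs _)

theorem norm_le_of_twoBumps_ne_zero {q : Space d → ℂ} (hq : ∀ ξ, q ξ ≠ 0 → ‖ξ‖ ≤ 2) {e : Space d}
    (he : ‖e‖ = 1) {n N : ℕ} {ξ : Space d} (h : twoBumps q e n N ξ ≠ 0) :
    ‖ξ‖ ≤ (n + 1) * N + 2 := by
  have hN : (0 : ℝ) ≤ N := N.cast_nonneg
  have hnN : (0 : ℝ) ≤ n * N := by positivity
  have key : ∀ t : ℝ, q (ξ - t • e) ≠ 0 → ‖ξ‖ ≤ |t| + 2 := fun t ht => by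
    have h1 := hq _ ht
    have h2 := norm_le_norm_add_norm_sub' ξ (t • e)
    rw [norm_smul, he, mul_one, Real.norm_eq_abs] at h2
    linarith
  by_cases h0 : q (ξ - (N : ℝ) • e) = 0
  · have := key (-(n * N : ℝ)) fun h1 => h (by rw [twoBumps, h0, h1, add_zero])
    rw [abs_neg, abs_of_nonneg hnN] at this
    linarith
  · have := key _ h0
    rw [abs_of_nonneg hN] at this
    linarith

/-- The norm of the two bumps, undamped with the parameter `1 / (N + 1)`, is bounded uniformly in
`N`. -/
theorem exists_norm_undamp_twoBumps_le {q : Space d → ℂ} (hc : Continuous q)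
    (hs : HasCompactSupport q) (hq : ∀ ξ, q ξ ≠ 0 → ‖ξ‖ ≤ 2) {e : Space d} (he : ‖e‖ = 1) (n : ℕ) :
    ∃ C, ∀ N : ℕ, ‖undamp (1 / (N + 1 : ℝ)) (twoBumps q e n N) (continuous_twoBumps hc e n N)
      (hasCompactSupport_twoBumps hs e n N)‖ ≤ C := by
  obtain ⟨C, hC⟩ := hs.exists_bound_of_continuous hc
  have hi : Integrable q := hc.integrable_of_hasCompactSupport hs
  -- On the support `|ξ| ≤ (n + 1) N + 2 ≤ (n + 3) (N + 1)`, hence the exponent `n + 3`.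
  refine ⟨Real.exp (n + 3) * max (C + C) ((∫ ξ, ‖q ξ‖) + ∫ ξ, ‖q ξ‖), fun N => norm_undamp_le _ _
    (fun ξ => ?_) ?_ fun ξ h => ?_⟩
  · exact ((norm_add_le _ _).trans (add_le_add (hC _) (hC _))).trans (le_max_left _ _)
  · refine le_trans ?_ (le_max_right _ _)
    have h1 := (hi.comp_sub_right ((N : ℝ) • e)).norm
    have h2 := (hi.comp_sub_right ((-(n * N : ℝ)) • e)).norm
    calc ∫ ξ, ‖twoBumps q e n N ξ‖
        ≤ ∫ ξ, (‖q (ξ - (N : ℝ) • e)‖ + ‖q (ξ - (-(n * N : ℝ)) • e)‖) := by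
          refine integral_mono ?_ (h1.add h2) fun ξ => norm_add_le _ _
          exact ((continuous_twoBumps hc e n N).integrable_of_hasCompactSupport
            (hasCompactSupport_twoBumps hs e n N)).norm
      _ = (∫ ξ, ‖q ξ‖) + ∫ ξ, ‖q ξ‖ := by
          rw [integral_add h1 h2, integral_sub_right_eq_self (fun ξ => ‖q ξ‖),
            integral_sub_right_eq_self (fun ξ => ‖q ξ‖)]
  · have h1 := norm_le_of_twoBumps_ne_zero hq he h
    have hN : (0 : ℝ) ≤ N := N.cast_nonneg
    rw [one_div, inv_mul_le_iff₀ (by positivity)]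
    have hn : (0 : ℝ) ≤ n := n.cast_nonneg
    nlinarith

/-- The phase `e^{2πi⟨c, x⟩}`. -/
abbrev phase (c x : Space d) : ℂ := (Real.fourierChar (inner ℝ c x) : ℂ)

theorem norm_phase (c x : Space d) : ‖phase c x‖ = 1 := Circle.norm_coe _

theorem continuous_phase (c : Space d) : Continuous (phase c) := by
  unfold phase
  exact continuous_subtype_val.comp (Real.continuous_fourierChar.comp (by fun_prop))

theorem fn_twoBumps {q : Space d → ℂ} (hc : Continuous q) (hs : HasCompactSupport q) {e : Space d}
    {n N : ℕ} {f g : WienerAlgebra d} (hf : (f : Space d → ℂ) =ᵐ[volume] twoBumps q e n N)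
    (hg : (g : Space d → ℂ) =ᵐ[volume] q) (x : Space d) :
    fn f x = (phase ((N : ℝ) • e) x + phase ((-(n * N : ℝ)) • e) x) * fn g x := by
  have hi : Integrable q := hc.integrable_of_hasCompactSupport hs
  have h1 : fn f x = 𝓕⁻ (twoBumps q e n N) x := by
    change 𝓕⁻ (f : Space d → ℂ) x = _
    rw [Real.fourierInv_eq, Real.fourierInv_eq]
    exact integral_congr_ae (by filter_upwards [hf] with ξ h; rw [h])
  have h2 : fn g x = 𝓕⁻ q x := by
    change 𝓕⁻ (g : Space d → ℂ) x = _
    rw [Real.fourierInv_eq, Real.fourierInv_eq]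
    exact integral_congr_ae (by filter_upwards [hg] with ξ h; rw [h])
  have h3 : ∀ c : Space d, Integrable fun ξ => Real.fourierChar (inner ℝ ξ x) • q (ξ - c) :=
    fun c => by
      have hi' := hi.comp_sub_right c
      refine (integrable_norm_iff ?_).1 (by simpa using hi'.norm)
      exact (Real.continuous_fourierChar.comp (by fun_prop)).aestronglyMeasurable.smul
        hi'.aestronglyMeasurable
  rw [h1, h2, add_mul, ← fourierInv_translate, ← fourierInv_translate, Real.fourierInv_eq,
    Real.fourierInv_eq, Real.fourierInv_eq, ← integral_add (h3 _) (h3 _)]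
  simp only [twoBumps, smul_add]

/-- The frequencies add up to `N (j - n (n + 1 - j)) = N (n + 1) (j - n)`, which vanishes for `N >
0` only when `j = n`. -/
theorem phase_pow_mul_phase_pow (e x : Space d) (n N j : ℕ) (hj : j ≤ n + 1) :
    phase ((N : ℝ) • e) x ^ j * phase ((-(n * N : ℝ)) • e) x ^ (n + 1 - j)
      = phase ((N * ((n + 1) * ((j : ℝ) - n))) • e) x := by
  simp only [phase, Real.fourierChar_apply, ← Complex.exp_nat_mul, ← Complex.exp_add,
    inner_smul_left, Nat.cast_sub hj]
  congr 1
  push_cast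
  simp
  ring

theorem integrable_schwartz_mul (η : 𝓢(Space d, ℂ)) (G : Space d →ᵇ ℂ) :
    Integrable fun x => η x * G x :=
  η.integrable.mul_bdd (c := ‖G‖) G.continuous.aestronglyMeasurable
    (Eventually.of_forall G.norm_coe_le_norm)

theorem tendsto_norm_natCast_mul_smul {e : Space d} (he : ‖e‖ = 1) {a : ℝ} (ha : a ≠ 0) :
    Tendsto (fun N : ℕ => ‖((N : ℝ) * a) • e‖) atTop atTop := by
  simp only [norm_smul, he, mul_one, norm_mul, Real.norm_natCast]
  exact tendsto_natCast_atTop_atTop.atTop_mul_const (norm_pos_iff.2 ha)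

section

variable {q : Space d → ℂ} {e : Space d} {n : ℕ} {f : ℕ → WienerAlgebra d} {g : WienerAlgebra d}

/-- Both phases oscillate faster and faster, the second because `n ≥ 1`. -/
theorem tendsto_toDist_twoBumps (hc : Continuous q) (hs : HasCompactSupport q) (he : ‖e‖ = 1)
    (hn : 1 ≤ n) (hf : ∀ N, (f N : Space d → ℂ) =ᵐ[volume] twoBumps q e n N)
    (hg : (g : Space d → ℂ) =ᵐ[volume] q) (η : 𝓢(Space d, ℂ)) :
    Tendsto (fun N => toDist (fn (f N)) η) atTop (𝓝 0) := by
  have hn' : (n : ℝ) ≠ 0 := by positivity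
  have h1 := tendsto_integral_fourierChar_mul (fun x => η x * fn g x)
    (tendsto_norm_natCast_mul_smul he one_ne_zero)
  have h2 := tendsto_integral_fourierChar_mul (fun x => η x * fn g x)
    (tendsto_norm_natCast_mul_smul he (neg_ne_zero.2 hn'))
  have h3 := h1.add h2
  rw [add_zero] at h3
  refine h3.congr fun N => ?_
  have hint : ∀ c : Space d, Integrable fun x => phase c x * (η x * fn g x) := fun c =>
    (integrable_schwartz_mul η (fn g)).bdd_mul (c := 1) (continuous_phase c).aestronglyMeasurable
      (Eventually.of_forall fun x => (norm_phase c x).le)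
  rw [toDist_apply, ← integral_add (hint _) (hint _)]
  refine integral_congr_ae (Eventually.of_forall fun x => ?_)
  simp only [fn_twoBumps hc hs (hf N) hg, phase, mul_one, mul_neg, mul_comm (N : ℝ) (n : ℝ)]
  ring

/-- Expand by the binomial theorem: Riemann-Lebesgue removes every term but the resonant one `j =
n`, whose coefficient is `(n + 1).choose n = n + 1`. -/
theorem tendsto_toDist_twoBumps_pow (hc : Continuous q) (hs : HasCompactSupport q) (he : ‖e‖ = 1)
    (hf : ∀ N, (f N : Space d → ℂ) =ᵐ[volume] twoBumps q e n N)
    (hg : (g : Space d → ℂ) =ᵐ[volume] q) (η : 𝓢(Space d, ℂ)) :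
    Tendsto (fun N => toDist (fn (f N) ^ (n + 1)) η) atTop
      (𝓝 ((n + 1) * toDist (fn g ^ (n + 1)) η)) := by
  set F : Space d → ℂ := fun x => η x * (fn g ^ (n + 1)) x with hF
  have hFi : Integrable F := integrable_schwartz_mul η (fn g ^ (n + 1))
  have hint : ∀ c : Space d, Integrable fun x => phase c x * F x := fun c =>
    hFi.bdd_mul (c := 1) (continuous_phase c).aestronglyMeasurable
      (Eventually.of_forall fun x => (norm_phase c x).le)
  have hlim : ∀ j ∈ Finset.range (n + 1 + 1), Tendsto (fun N : ℕ => ((n + 1).choose j : ℂ) *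
      ∫ x, phase ((N * ((n + 1) * ((j : ℝ) - n))) • e) x * F x) atTop
      (𝓝 (if j = n then (n + 1) * ∫ x, F x else 0)) := fun j hj => by
    split_ifs with h
    · subst h
      simp [phase, Nat.choose_succ_self_right]
    · rw [← mul_zero ((n + 1).choose j : ℂ)]
      refine Tendsto.const_mul _ (tendsto_integral_fourierChar_mul F
        (tendsto_norm_natCast_mul_smul he ?_))
      have : (j : ℝ) - n ≠ 0 := sub_ne_zero.2 (by exact_mod_cast h)
      positivity
  have hsum := tendsto_finsetSum _ hlim
  rw [Finset.sum_ite_eq' (Finset.range (n + 1 + 1)) n, if_pos (by simp)] at hsum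
  rw [toDist_apply]
  refine hsum.congr fun N => ?_
  rw [toDist_apply]
  have hx : ∀ x, η x * (fn (f N) ^ (n + 1)) x = ∑ j ∈ Finset.range (n + 1 + 1),
      ((n + 1).choose j : ℂ) * (phase ((N * ((n + 1) * ((j : ℝ) - n))) • e) x * F x) := fun x => by
    rw [BoundedContinuousFunction.pow_apply, fn_twoBumps hc hs (hf N) hg, mul_pow, add_pow,
      Finset.sum_mul, Finset.mul_sum]
    refine Finset.sum_congr rfl fun j hj => ?_
    rw [← phase_pow_mul_phase_pow e x n N j (by simpa [Nat.lt_succ_iff] using hj), hF]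
    simp only [BoundedContinuousFunction.pow_apply]
    ring
  simp_rw [hx]
  rw [integral_finsetSum _ fun j _ => (hint _).const_mul _]
  simp_rw [integral_const_mul]

/-- Otherwise the Laplacian of the power, itself in the Wiener algebra, would vanish, and so would
the power; but its value at the origin is `(∫ q) ^ (n + 1)`. -/
theorem exists_toDist_pow_laplacian_ne_zero (hd : 1 ≤ d) (hc : Continuous q)
    (hs : HasCompactSupport q) (hq : ∫ ξ, q ξ ≠ 0) (n : ℕ) :
    ∃ ζ : 𝓢(Space d, ℂ),
      toDist (fn (toWiener 0 le_rfl (undamp 0 q hc hs)) ^ (n + 1)) (Δ ζ) ≠ 0 := by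
  by_contra! h
  have h0 : Δ (toDist (fn (toWiener 0 le_rfl
      (iterMul (wmul 0 le_rfl) n (undamp 0 q hc hs))))) = 0 := by
    ext ζ
    rw [TemperedDistribution.laplacian_apply_apply, fn_toWiener_iterMul, h]
    rfl
  have h1 := eq_zero_of_laplacian_eq_zero hd h0
  have h2 := fn_toWiener_iterMul 0 le_rfl n (undamp 0 q hc hs)
  rw [h1] at h2
  have h3 : fn (toWiener 0 le_rfl (undamp 0 q hc hs)) 0 = ∫ ξ, q ξ := by
    rw [fn_toWiener_apply, Real.fourierInv_eq]
    simp only [damp_undamp]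
    simp
  have h4 : fn (0 : WienerAlgebra d) 0 = 0 := by
    have := norm_fn_apply_le (0 : WienerAlgebra d) 0
    rwa [norm_zero, norm_le_zero_iff] at this
  have h5 := congrArg (fun F : Space d →ᵇ ℂ => F 0) h2
  simp only [BoundedContinuousFunction.pow_apply, h4, h3] at h5
  exact pow_ne_zero _ hq h5.symm

end

/-! ### Local existence and Taylor expansion in time. -/

/-- The nonlinearity `-m(D)(v + v^(n+1))`, on the weighted Fourier side. -/
def field (δ : ℝ) (hδ : 0 ≤ δ) (n : ℕ) (x : CI d) : CI d :=
  -mulBdd symb continuous_symb norm_symb_le (x + iterMul (wmul δ hδ) n x)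

theorem norm_field_le (δ : ℝ) (hδ : 0 ≤ δ) (n : ℕ) (x : CI d) :
    ‖field δ hδ n x‖ ≤ ‖x‖ + ‖x‖ ^ (n + 1) := by
  rw [field, norm_neg]
  exact (norm_mulBdd_le _).trans ((norm_add_le _ _).trans
    (add_le_add le_rfl (norm_iterMul_le norm_wmul_le n x)))

theorem norm_field_sub_le (δ : ℝ) (hδ : 0 ≤ δ) (n : ℕ) {M : ℝ} {x y : CI d} (hx : ‖x‖ ≤ M)
    (hy : ‖y‖ ≤ M) : ‖field δ hδ n x - field δ hδ n y‖ ≤ (1 + (n + 1) * M ^ n) * ‖x - y‖ := by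
  rw [field, field, neg_sub_neg, ← mulBdd_sub, add_sub_add_comm, add_mul, one_mul, norm_sub_rev x]
  refine (norm_mulBdd_le _).trans ((norm_add_le _ _).trans (add_le_add le_rfl ?_))
  exact norm_iterMul_sub_le norm_wmul_le wmul_sub_left wmul_sub_right n hy hx

/-- The ODE is solved for the weighted transform and carried over by the continuous linear map
`toWiener`, which commutes with time derivatives. The hypothesis `hF` says that `l` is large enough
for the nonlinearity at size `2 r`. -/
theorem exists_isSolution {δ : ℝ} (hδ : 0 ≤ δ) (n : ℕ) {r l c T : ℝ} (hr : 0 ≤ r) (hl : 0 < l)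
    (hc : 2 ≤ c) (hT : 0 < T) (hlT : l * c * T ≤ 1)
    (hF : 2 * r + (2 * r) ^ (n + 1) ≤ l ^ 2 * (c * r)) {φ ψ : CI d} (hφ : ‖φ‖ ≤ r)
    (hψ : ‖ψ‖ ≤ l * r) :
    ∃ v : ℝ → CI d, IsSolution (n + 1) T (fun t => toWiener δ hδ (v t)) ∧ v 0 = φ ∧
      dt T (fun t => toWiener δ hδ (v t)) 0 = toWiener δ hδ ψ ∧
      ∀ t ∈ Icc 0 T, ‖v t‖ ≤ 2 * r ∧ ‖v t - φ‖ ≤ l * c * r * t := by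
  have hM : (0 : ℝ) ≤ 1 + (n + 1) * (2 * r) ^ n := by positivity
  have hK : LipschitzOnWith ⟨_, hM⟩ (field δ hδ n : CI d → CI d) (closedBall 0 (2 * r)) := by
    refine LipschitzOnWith.of_dist_le_mul fun x hx y hy => ?_
    rw [dist_eq_norm, dist_eq_norm]
    exact norm_field_sub_le δ hδ n (mem_closedBall_zero_iff.1 hx) (mem_closedBall_zero_iff.1 hy)
  obtain ⟨v, w, hv0, hw0, h⟩ := exists_solution_second_order (F := (field δ hδ n : CI d → CI d))
    hr hl hc hT.le hlT (fun x hx => (norm_field_le δ hδ n x).trans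
      ((add_le_add hx (by gcongr)).trans hF)) hK hφ hψ
  have hu : UniqueDiffOn ℝ (Icc 0 T) := uniqueDiffOn_Icc hT
  set u : ℝ → WienerAlgebra d := fun t => toWiener δ hδ (v t) with hu_def
  have h0 : (0 : ℝ) ∈ Icc 0 T := ⟨le_rfl, hT.le⟩
  have hd1 : ∀ t ∈ Icc 0 T, HasDerivWithinAt u (toWiener δ hδ (w t)) (Icc 0 T) t := fun t ht =>
    (toWiener δ hδ).hasFDerivAt.comp_hasDerivWithinAt t (h t ht).1
  have hdt : ∀ t ∈ Icc 0 T, dt T u t = toWiener δ hδ (w t) := fun t ht =>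
    (hd1 t ht).derivWithin (hu t ht)
  have hd2 : ∀ t ∈ Icc 0 T,
      HasDerivWithinAt (dt T u) (toWiener δ hδ (field δ hδ n (v t))) (Icc 0 T) t := fun t ht =>
    ((toWiener δ hδ).hasFDerivAt.comp_hasDerivWithinAt t (h t ht).2.1).congr hdt (hdt t ht)
  have hdtt : ∀ t ∈ Icc 0 T, dtt T u t = toWiener δ hδ (field δ hδ n (v t)) := fun t ht =>
    (hd2 t ht).derivWithin (hu t ht)
  refine ⟨v, ⟨?_, fun t ht => ?_⟩, hv0, by rw [hdt 0 h0, hw0], fun t ht => (h t ht).2.2⟩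
  · have h2 : (2 : WithTop ℕ∞) = 1 + 1 := by norm_num
    rw [h2, contDiffOn_succ_iff_derivWithin hu]
    refine ⟨fun t ht => (hd1 t ht).differentiableWithinAt, by simp, ?_⟩
    rw [contDiffOn_one_iff_derivWithin hu]
    refine ⟨fun t ht => (hd2 t ht).differentiableWithinAt, ?_⟩
    have hcont : ContinuousOn (fun t => toWiener δ hδ (field δ hδ n (v t))) (Icc 0 T) :=
      (toWiener δ hδ).continuous.comp_continuousOn (hK.continuousOn.comp
        (fun t ht => (h t ht).1.continuousWithinAt)
        fun t ht => mem_closedBall_zero_iff.2 (h t ht).2.2.1)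
    exact hcont.congr hdtt
  · rw [hdtt t ht]
    refine equation_of_ae_eq (fn_toWiener_iterMul δ hδ n (v t)) ?_
    filter_upwards [toWiener_ae δ hδ (field δ hδ n (v t)), toWiener_ae δ hδ (v t),
      toWiener_ae δ hδ (iterMul (wmul δ hδ) n (v t))] with ξ h1 h2 h3
    rw [h1, h2, h3]
    simp only [damp_apply, field, CI.neg_apply, mulBdd_apply, CI.add_apply]
    ring

/-- The mean value inequality, applied twice; this gives `E` rather than `E / 2`, which suffices. -/
theorem norm_taylor_two_sub_le {y y' y'' : ℝ → ℂ} {T E : ℝ} {A : ℂ} (hT : 0 ≤ T)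
    (h1 : ∀ t ∈ Icc 0 T, HasDerivWithinAt y (y' t) (Icc 0 T) t)
    (h2 : ∀ t ∈ Icc 0 T, HasDerivWithinAt y' (y'' t) (Icc 0 T) t)
    (hE : ∀ t ∈ Icc 0 T, ‖y'' t - A‖ ≤ E) :
    ‖y T - y 0 - T * y' 0 - T ^ 2 / 2 * A‖ ≤ E * T ^ 2 := by
  have h0 : (0 : ℝ) ∈ Icc 0 T := ⟨le_rfl, hT⟩
  have hTT : T ∈ Icc 0 T := ⟨hT, le_rfl⟩
  have hid : ∀ t : ℝ, HasDerivWithinAt (fun t : ℝ => (t : ℂ)) 1 (Icc 0 T) t := fun t =>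
    Complex.ofRealCLM.hasDerivWithinAt
  have hg : ∀ t ∈ Icc 0 T, ‖y' t - y' 0 - t * A‖ ≤ E * T := fun t ht => by
    have hd : ∀ x ∈ Icc 0 T, HasDerivWithinAt (fun t => y' t - t * A) (y'' x - A) (Icc 0 T) x :=
      fun x hx => by simpa using (h2 x hx).fun_sub ((hid x).mul_const A)
    have h := (convex_Icc 0 T).norm_image_sub_le_of_norm_hasDerivWithin_le hd hE h0 ht
    have hE0 : 0 ≤ E := (norm_nonneg _).trans (hE 0 h0)
    have h' : E * ‖t - 0‖ ≤ E * T := by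
      rw [sub_zero, Real.norm_of_nonneg ht.1]
      exact mul_le_mul_of_nonneg_left ht.2 hE0
    refine le_trans (le_of_eq ?_) (h.trans h')
    congr 1
    simp
    ring
  have hd : ∀ x ∈ Icc 0 T, HasDerivWithinAt (fun t : ℝ => y t - t * y' 0 - (t : ℂ) ^ 2 / 2 * A)
      (y' x - y' 0 - x * A) (Icc 0 T) x := fun x hx => by
    have := ((h1 x hx).fun_sub ((hid x).mul_const (y' 0))).fun_sub
      ((((hid x).fun_pow 2).div_const 2).mul_const A)
    refine this.congr_deriv ?_
    push_cast
    ring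
  have h := (convex_Icc 0 T).norm_image_sub_le_of_norm_hasDerivWithin_le hd hg h0 hTT
  rw [sub_zero, Real.norm_of_nonneg hT] at h
  refine le_trans (le_of_eq ?_) (h.trans (le_of_eq (by ring)))
  congr 1
  simp
  ring

/-- The pairing of an element of the Wiener algebra with a Schwartz function. -/
def pairing (η : 𝓢(Space d, ℂ)) : WienerAlgebra d →L[ℝ] ℂ :=
  ((PointwiseConvergenceCLM.evalCLM (RingHom.id ℂ) ℂ η).comp (distCLM d)).restrictScalars ℝ

theorem pairing_apply (η : 𝓢(Space d, ℂ)) (f : WienerAlgebra d) :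
    pairing η f = toDist (fn f) η :=
  congrArg (fun D : 𝓢'(Space d, ℂ) => D η) (distCLM_apply f)

/-- Testing against `(1 - Δ) ζ` removes the operator in front of `u_tt`: `⟨u_tt, (1 - Δ) ζ⟩ = ⟨u +
u^k, Δ ζ⟩`. -/
theorem IsSolution.norm_pairing_taylor_le {k : ℕ} {T : ℝ} {u : ℝ → WienerAlgebra d}
    (hu : IsSolution k T u) (hT : 0 < T) (ζ : 𝓢(Space d, ℂ)) {A : ℂ} {E : ℝ}
    (hE : ∀ t ∈ Icc 0 T, ‖toDist (fn (u t)) (Δ ζ) + toDist (fn (u t) ^ k) (Δ ζ) - A‖ ≤ E) :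
    ‖pairing (ζ - Δ ζ) (u T) - pairing (ζ - Δ ζ) (u 0) - T * pairing (ζ - Δ ζ) (dt T u 0)
      - T ^ 2 / 2 * A‖ ≤ E * T ^ 2 := by
  have hud : UniqueDiffOn ℝ (Icc 0 T) := uniqueDiffOn_Icc hT
  have h2 : (2 : WithTop ℕ∞) = 1 + 1 := by norm_num
  have hC := hu.contDiffOn
  rw [h2, contDiffOn_succ_iff_derivWithin hud] at hC
  have hd1 : ∀ t ∈ Icc 0 T, HasDerivWithinAt u (dt T u t) (Icc 0 T) t := fun t ht =>
    (hC.1 t ht).hasDerivWithinAt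
  have hd2 : ∀ t ∈ Icc 0 T, HasDerivWithinAt (dt T u) (dtt T u t) (Icc 0 T) t := fun t ht =>
    (hC.2.2.differentiableOn (by norm_num) t ht).hasDerivWithinAt
  refine norm_taylor_two_sub_le (y := fun t => pairing (ζ - Δ ζ) (u t))
    (y' := fun t => pairing (ζ - Δ ζ) (dt T u t)) (y'' := fun t => pairing (ζ - Δ ζ) (dtt T u t))
    hT.le
    (fun t ht => (pairing (ζ - Δ ζ)).hasFDerivAt.comp_hasDerivWithinAt t (hd1 t ht))
    (fun t ht => (pairing (ζ - Δ ζ)).hasFDerivAt.comp_hasDerivWithinAt t (hd2 t ht))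
    fun t ht => ?_
  have heq := congrArg (fun D : 𝓢'(Space d, ℂ) => D ζ) (hu.equation t ht)
  simp only [sub_apply, TemperedDistribution.laplacian_apply_apply] at heq
  have : pairing (ζ - Δ ζ) (dtt T u t)
      = toDist (fn (u t)) (Δ ζ) + toDist (fn (u t) ^ k) (Δ ζ) := by
    rw [pairing_apply, map_sub]
    linear_combination heq
  rw [this]
  exact hE t ht

theorem norm_toDist_fn_apply_le (f : WienerAlgebra d) (η : 𝓢(Space d, ℂ)) :
    ‖toDist (fn f) η‖ ≤ (∫ x, ‖η x‖) * ‖f‖ := by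
  rw [toDist_apply, ← integral_mul_const]
  refine norm_integral_le_of_norm_le (η.integrable.norm.mul_const _)
    (Eventually.of_forall fun x => ?_)
  rw [norm_mul]
  exact mul_le_mul_of_nonneg_left (norm_fn_apply_le f x) (norm_nonneg _)

theorem fn_smul (c : ℝ) (f : WienerAlgebra d) : fn (c • f) = (c : ℂ) • fn f := by
  ext x
  change 𝓕⁻ ((c • f : WienerAlgebra d) : Space d → ℂ) x = (c : ℂ) * 𝓕⁻ (f : Space d → ℂ) x
  rw [Real.fourierInv_eq, Real.fourierInv_eq, ← integral_const_mul]
  refine integral_congr_ae ?_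
  filter_upwards [Lp.coeFn_smul c f] with ξ h
  rw [h]
  simp only [Pi.smul_apply, Circle.smul_def, smul_eq_mul, Complex.real_smul]
  ring

theorem toDist_fn_smul_pow (c : ℝ) (f : WienerAlgebra d) (k : ℕ) (η : 𝓢(Space d, ℂ)) :
    toDist (fn (c • f) ^ k) η = (c : ℂ) ^ k * toDist (fn f ^ k) η := by
  rw [toDist_apply, toDist_apply, ← integral_const_mul]
  refine integral_congr_ae (Eventually.of_forall fun x => ?_)
  simp only [fn_smul, smul_pow, BoundedContinuousFunction.smul_apply, smul_eq_mul]
  ring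

/-- The forcing `u + u ^ (n + 1)` is close to its leading term when `u` is close to its initial
value. -/
theorem norm_forcing_sub_le {δ : ℝ} (hδ : 0 ≤ δ) {n : ℕ} (hn : 1 ≤ n) {A B c τ R : ℝ}
    (hA : 0 ≤ A) (hB : 0 ≤ B) (hc : 0 ≤ c) (hτ : 0 ≤ τ) (hR : 1 ≤ R) {x β : CI d}
    (hx : ‖x‖ ≤ 2 * (B * R)) (hβ : ‖R • β‖ ≤ 2 * (B * R))
    (hxβ : ‖x - R • β‖ ≤ A + c * B * R * τ) (η : 𝓢(Space d, ℂ)) :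
    ‖toDist (fn (toWiener δ hδ x)) η + toDist (fn (toWiener δ hδ x) ^ (n + 1)) η
      - (R : ℂ) ^ (n + 1) * toDist (fn (toWiener δ hδ β) ^ (n + 1)) η‖
      ≤ (∫ y, ‖η y‖) * (2 * B + (n + 1) * (2 * B) ^ n * (A + c * B)) * (R ^ n * (1 + R * τ)) := by
  set I := ∫ y, ‖η y‖ with hI
  have hI0 : 0 ≤ I := integral_nonneg fun _ => norm_nonneg _
  have hR0 : 0 < R := by linarith
  have hRn : R ≤ R ^ n := le_self_pow₀ hR (by omega)
  have h4 := norm_iterMul_sub_le (norm_wmul_le (δ := δ) (hδ := hδ)) wmul_sub_left wmul_sub_right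
    n hx hβ
  -- The difference of powers comes from a difference of `iterMul`s, to which the Lipschitz bound
  -- applies.
  have h5 : toDist (fn (toWiener δ hδ x) ^ (n + 1)) η
      - (R : ℂ) ^ (n + 1) * toDist (fn (toWiener δ hδ β) ^ (n + 1)) η
      = toDist (fn (toWiener δ hδ (iterMul (wmul δ hδ) n x
          - iterMul (wmul δ hδ) n (R • β)))) η := by
    rw [← toDist_fn_smul_pow, ← map_smul, ← fn_toWiener_iterMul, ← fn_toWiener_iterMul,
      ← pairing_apply, ← pairing_apply, ← pairing_apply, ← map_sub, ← map_sub]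
  rw [add_sub_assoc, h5]
  have h6 := (norm_toDist_fn_apply_le (toWiener δ hδ x) η).trans
    (mul_le_mul_of_nonneg_left ((norm_toWiener_le δ hδ _).trans hx) hI0)
  have h7 := (norm_toDist_fn_apply_le (toWiener δ hδ (iterMul (wmul δ hδ) n x
    - iterMul (wmul δ hδ) n (R • β))) η).trans
    (mul_le_mul_of_nonneg_left ((norm_toWiener_le δ hδ _).trans h4) hI0)
  refine (norm_add_le _ _).trans ((add_le_add h6 h7).trans ?_)
  have hRτ : 1 ≤ 1 + R * τ := le_add_of_nonneg_right (by positivity)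
  have h8 : 2 * (B * R) ≤ 2 * B * (R ^ n * (1 + R * τ)) := by
    calc 2 * (B * R) = 2 * B * (R * 1) := by ring
      _ ≤ 2 * B * (R ^ n * (1 + R * τ)) := by gcongr
  have h9 : A + c * B * R * τ ≤ (A + c * B) * (1 + R * τ) := by
    have : 0 ≤ A * (R * τ) + c * B := by positivity
    linarith
  have h10 := hxβ.trans h9
  calc I * (2 * (B * R)) + I * ((n + 1) * (2 * (B * R)) ^ n * ‖x - R • β‖)
      ≤ I * (2 * B * (R ^ n * (1 + R * τ)))
        + I * ((n + 1) * (2 * (B * R)) ^ n * ((A + c * B) * (1 + R * τ))) := by gcongr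
    _ = _ := by ring

theorem norm_le_of_norm_sub_sub_sub_le {y y₀ y₁ z : ℂ} {E : ℝ} (h : ‖y - y₀ - y₁ - z‖ ≤ E) :
    ‖z‖ ≤ ‖y‖ + ‖y₀‖ + ‖y₁‖ + E := by
  have e : z = y - y₀ - y₁ - (y - y₀ - y₁ - z) := by ring
  calc ‖z‖ = ‖y - y₀ - y₁ - (y - y₀ - y₁ - z)‖ := by rw [← e]
    _ ≤ ‖y - y₀ - y₁‖ + ‖y - y₀ - y₁ - z‖ := norm_sub_le _ _
    _ ≤ _ := add_le_add ((norm_sub_le _ _).trans (add_le_add (norm_sub_le _ _) le_rfl)) h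

/-! ### The lower bound at the final time. -/

/-- A solution with initial data `(α + ρ² β, ψ)` on the time interval `[0, τ / ρ ^ n]`, with a lower
bound at the final time in terms of the leading term `(ρ² β) ^ (n + 1)` of the nonlinearity. -/
theorem exists_isSolution_lower_bound {δ : ℝ} (hδ : 0 ≤ δ) {n : ℕ} (hn : 1 ≤ n) {A B c τ ρ : ℝ}
    (hA : 0 ≤ A) (hB : A + 1 ≤ B) (hc : c = 2 + 2 ^ (n + 1) * B ^ n) (hτ : 0 < τ)
    (hτc : c * τ ≤ 1) (hρ : 1 ≤ ρ) {α β ψ : CI d} (hα : ‖α‖ ≤ A) (hβ : ‖β‖ ≤ B - A)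
    (hψ : ‖ψ‖ ≤ A) (ζ : 𝓢(Space d, ℂ)) :
    ∃ v : ℝ → CI d, IsSolution (n + 1) (τ / ρ ^ n) (fun t => toWiener δ hδ (v t)) ∧
      v 0 = α + ρ ^ 2 • β ∧
      dt (τ / ρ ^ n) (fun t => toWiener δ hδ (v t)) 0 = toWiener δ hδ ψ ∧
      τ ^ 2 / 2 * ρ ^ 2 * ‖toDist (fn (toWiener δ hδ β) ^ (n + 1)) (Δ ζ)‖
        ≤ ‖toDist (fn (toWiener δ hδ (v (τ / ρ ^ n)))) (ζ - Δ ζ)‖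
          + ρ ^ 2 * ‖toDist (fn (toWiener δ hδ β)) (ζ - Δ ζ)‖
          + 2 * A * (∫ x, ‖(ζ - Δ ζ) x‖)
          + (∫ x, ‖(Δ ζ) x‖) * (2 * B + (n + 1) * (2 * B) ^ n * (A + c * B))
            * (τ ^ 2 * (1 + ρ ^ 2 * τ)) := by
  -- A square, so that the inverse time scale `R^{n/2}` is the integer power `ρ ^ n`.
  set R := ρ ^ 2 with hR
  set T := τ / ρ ^ n with hT_def
  set I := ∫ x, ‖(Δ ζ) x‖ with hI
  set I' := ∫ x, ‖(ζ - Δ ζ) x‖ with hI'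
  have hI0 : 0 ≤ I := integral_nonneg fun _ => norm_nonneg _
  have hI0' : 0 ≤ I' := integral_nonneg fun _ => norm_nonneg _
  have hB1 : 1 ≤ B := by linarith
  have hB0 : 0 < B := by linarith
  have hR1 : 1 ≤ R := one_le_pow₀ hρ
  have hR0 : 0 < R := by linarith
  have hl1 : 1 ≤ ρ ^ n := one_le_pow₀ hρ
  have hl0 : 0 < ρ ^ n := by linarith
  have hlR : (ρ ^ n) ^ 2 = R ^ n := by rw [hR, ← pow_mul, ← pow_mul, mul_comm]
  have hRn : R ≤ R ^ n := by
    calc R = R ^ 1 := (pow_one R).symm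
      _ ≤ R ^ n := pow_le_pow_right₀ hR1 hn
  have hRn1 : 1 ≤ R ^ n := one_le_pow₀ hR1
  have hc2 : 2 ≤ c := by rw [hc]; have : 0 ≤ 2 ^ (n + 1) * B ^ n := by positivity
                         linarith
  have hc0 : 0 < c := by linarith
  have hT : 0 < T := by positivity
  have hlT : ρ ^ n * T = τ := by rw [hT_def]; field_simp
  have hτ1 : τ ≤ 1 := by nlinarith
  have hT1 : T ≤ 1 := (div_le_self hτ.le hl1).trans hτ1
  have hφ : ‖α + R • β‖ ≤ B * R := by
    refine (norm_add_le _ _).trans ?_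
    rw [norm_smul, Real.norm_of_nonneg hR0.le]
    nlinarith
  have hψ' : ‖ψ‖ ≤ ρ ^ n * (B * R) := by
    have : 1 * (B * 1) ≤ ρ ^ n * (B * R) := by gcongr
    linarith
  -- The value of `c` is read off here: its two summands pay for the linear term and for the power.
  have hF : 2 * (B * R) + (2 * (B * R)) ^ (n + 1) ≤ (ρ ^ n) ^ 2 * (c * (B * R)) := by
    have h1 : (2 * (B * R)) ^ (n + 1) = R ^ n * (2 ^ (n + 1) * B ^ n * (B * R)) := by ring
    have h2 : 1 * (2 * (B * R)) ≤ R ^ n * (2 * (B * R)) := by gcongr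
    rw [hlR, hc, h1]
    linarith
  obtain ⟨v, hsol, hv0, hdt, hv⟩ := exists_isSolution hδ n (r := B * R) (l := ρ ^ n) (c := c)
    (T := T) (by positivity) hl0 hc2 hT (by rw [mul_right_comm, hlT, mul_comm]; exact hτc) hF hφ hψ'
  refine ⟨v, hsol, hv0, hdt, ?_⟩
  set b := toWiener δ hδ β with hb
  set κ := toDist (fn b ^ (n + 1)) (Δ ζ) with hκ
  set K := I * (2 * B + (n + 1) * (2 * B) ^ n * (A + c * B)) with hK
  have hK0 : 0 ≤ K := by positivity
  have hE : ∀ t ∈ Icc 0 T, ‖toDist (fn (toWiener δ hδ (v t))) (Δ ζ)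
      + toDist (fn (toWiener δ hδ (v t)) ^ (n + 1)) (Δ ζ) - (R : ℂ) ^ (n + 1) * κ‖
      ≤ K * (R ^ n * (1 + R * τ)) := fun t ht => by
    obtain ⟨h1, h2⟩ := hv t ht
    refine norm_forcing_sub_le hδ hn hA hB0.le hc0.le hτ.le hR1 h1 ?_ ?_ (Δ ζ)
    · rw [norm_smul, Real.norm_of_nonneg hR0.le]
      nlinarith
    · have e : v t - R • β = α + (v t - (α + R • β)) := by abel
      rw [e]
      refine (norm_add_le _ _).trans (add_le_add hα (h2.trans ?_))
      calc ρ ^ n * c * (B * R) * t ≤ ρ ^ n * c * (B * R) * T := by gcongr; exact ht.2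
        _ = c * B * R * (ρ ^ n * T) := by ring
        _ = c * B * R * τ := by rw [hlT]
  have hmain := hsol.norm_pairing_taylor_le hT ζ hE
  simp only [hdt, hv0, pairing_apply] at hmain
  -- Hence the leading term `T² R ^ (n + 1)` is only `τ² R`, still linear in `R`.
  have hT2 : T ^ 2 * R ^ n = τ ^ 2 := by rw [← hlR, ← mul_pow, mul_comm, hlT]
  have hrhs : K * (R ^ n * (1 + R * τ)) * T ^ 2 = K * (τ ^ 2 * (1 + R * τ)) := by
    rw [← hT2]; ring
  rw [hrhs] at hmain
  have hlead : ‖(T : ℂ) ^ 2 / 2 * ((R : ℂ) ^ (n + 1) * κ)‖ = τ ^ 2 / 2 * R * ‖κ‖ := by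
    rw [← hT2]
    simp only [norm_mul, norm_div, norm_pow, Complex.norm_real, Real.norm_of_nonneg hT.le,
      Real.norm_of_nonneg hR0.le, Complex.norm_ofNat]
    ring
  have hψb : ‖(T : ℂ) * toDist (fn (toWiener δ hδ ψ)) (ζ - Δ ζ)‖ ≤ A * I' := by
    rw [norm_mul, Complex.norm_real, Real.norm_of_nonneg hT.le]
    calc T * ‖toDist (fn (toWiener δ hδ ψ)) (ζ - Δ ζ)‖ ≤ 1 * (I' * A) := by
          gcongr
          exact (norm_toDist_fn_apply_le _ _).trans
            (mul_le_mul_of_nonneg_left ((norm_toWiener_le δ hδ ψ).trans hψ) hI0')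
      _ = A * I' := by ring
  have hφb : ‖toDist (fn (toWiener δ hδ (α + R • β))) (ζ - Δ ζ)‖
      ≤ A * I' + R * ‖toDist (fn b) (ζ - Δ ζ)‖ := by
    rw [← pairing_apply, map_add, map_add, map_smul, map_smul, pairing_apply, pairing_apply]
    refine (norm_add_le _ _).trans (add_le_add ?_ ?_)
    · rw [mul_comm]
      exact (norm_toDist_fn_apply_le _ _).trans
        (mul_le_mul_of_nonneg_left ((norm_toWiener_le δ hδ α).trans hα) hI0')
    · rw [norm_smul, Real.norm_of_nonneg hR0.le]
  have htri := norm_le_of_norm_sub_sub_sub_le hmain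
  rw [hlead] at htri
  linarith

theorem tendsto_sobolevNorm_smul_twoBumps {s : ℝ} (hs : s < 0) {q : Space d → ℂ}
    (hc : Continuous q) (hq : HasCompactSupport q) {e : Space d} (he : ‖e‖ = 1) {n : ℕ}
    (hn : 1 ≤ n) (R : ℝ) {f : ℕ → WienerAlgebra d}
    (hf : ∀ N, (f N : Space d → ℂ) =ᵐ[volume] twoBumps q e n N) :
    Tendsto (fun N => sobolevNorm s (toDist (fn (R • f N)))) atTop (𝓝 0) := by
  have hRc : Continuous fun ξ => (R : ℂ) * q ξ := by fun_prop
  have hRs : HasCompactSupport fun ξ => (R : ℂ) * q ξ := hq.mul_left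
  have hn' : (n : ℝ) ≠ 0 := by positivity
  have key : ∀ a : ℝ, ∃ g : ℕ → WienerAlgebra d, ∀ N, (g N : Space d → ℂ) =ᵐ[volume]
      fun ξ => (R : ℂ) * q (ξ - ((N : ℝ) * a) • e) := fun a =>
    ⟨fun N => toWiener 0 le_rfl (undamp 0 (fun ξ => (R : ℂ) * q (ξ - ((N : ℝ) * a) • e))
      (hRc.comp (by fun_prop)) (hasCompactSupport_translate hRs _)),
      fun N => toWiener_undamp 0 le_rfl _ _ _⟩
  obtain ⟨g₁, hg₁⟩ := key 1
  obtain ⟨g₂, hg₂⟩ := key (-n)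
  have h1 := tendsto_sobolevNorm_translate hs hRc hRs
    (tendsto_norm_natCast_mul_smul he one_ne_zero) hg₁
  have h2 := tendsto_sobolevNorm_translate hs hRc hRs
    (tendsto_norm_natCast_mul_smul he (neg_ne_zero.2 hn')) hg₂
  have h3 := h1.add h2
  rw [add_zero] at h3
  refine tendsto_of_tendsto_of_tendsto_of_le_of_le tendsto_const_nhds h3 (fun _ => zero_le)
    fun N => ?_
  have hsum : R • f N = g₁ N + g₂ N := by
    refine Lp.ext ?_
    filter_upwards [hf N, hg₁ N, hg₂ N, Lp.coeFn_smul R (f N), Lp.coeFn_add (g₁ N) (g₂ N)]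
      with ξ a1 a2 a3 a4 a5
    rw [a4, a5, Pi.smul_apply, Pi.add_apply, a1, a2, a3, twoBumps, Complex.real_smul, mul_one,
      mul_neg, mul_comm (N : ℝ) (n : ℝ)]
    ring
  simp only [hsum, toDist_fn_add]
  exact sobolevNorm_add_le _ _ _

end GIBq

end

/-! ### Choice of parameters and conclusion. -/

open GIBq in
theorem mainTheorem7 (d : ℕ) (hd : 1 ≤ d) (k : ℕ) (hk : 2 ≤ k) (σ s : ℝ) (hs : s < 0)
    (u₀ u₁ : 𝓢'(GIBq.Space d, ℂ)) (hu₀ : MemSobolev s 2 u₀) (hu₁ : MemSobolev s 2 u₁)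
    (ε : ℝ) (hε : 0 < ε) :
    ∃ (T : ℝ) (u : ℝ → GIBq.WienerAlgebra d) (t : ℝ),
      GIBq.IsSolution k T u ∧ 0 < t ∧ t < ε ∧ t ≤ T ∧
      GIBq.sobolevPairNorm s (GIBq.toDist (GIBq.fn (u 0)) - u₀) (GIBq.toDist (GIBq.fn (GIBq.dt T u 0)) - u₁)
        < ENNReal.ofReal ε ∧
      MemSobolev σ 2 (GIBq.toDist (GIBq.fn (u t))) ∧
      ENNReal.ofReal ε⁻¹ < GIBq.sobolevNorm σ (GIBq.toDist (GIBq.fn (u t))) := by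
  obtain ⟨n, rfl⟩ : ∃ n, k = n + 1 := ⟨k - 1, by omega⟩
  have hn : 1 ≤ n := by omega
  -- Three quarters of `ε` pay for approximating `u₀` and `u₁` and for the bumps; the fourth is
  -- slack.
  have hε4 : ENNReal.ofReal (ε / 4) ≠ 0 := by simpa using hε
  obtain ⟨a₀, ha₀c, ha₀s, ha₀⟩ := exists_sobolevNorm_sub_le hu₀ hε4
  obtain ⟨a₁, ha₁c, ha₁s, ha₁⟩ := exists_sobolevNorm_sub_le hu₁ hε4
  obtain ⟨A₀, hA₀⟩ := exists_norm_undamp_le ha₀c ha₀s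
  obtain ⟨A₁, hA₁⟩ := exists_norm_undamp_le ha₁c ha₁s
  obtain ⟨q, hqc, hqs, hq2, hqi⟩ := exists_bump d
  obtain ⟨e, he⟩ : ∃ e : Space d, ‖e‖ = 1 := ⟨EuclideanSpace.single ⟨0, hd⟩ 1, by simp⟩
  obtain ⟨C, hC⟩ := exists_norm_undamp_twoBumps_le hqc hqs hq2 he n
  obtain ⟨ζ, hζ⟩ := exists_toDist_pow_laplacian_ne_zero hd hqc hqs hqi n
  obtain ⟨D, hD, hpair⟩ := exists_enorm_apply_le_mul_sobolevNorm σ (ζ - Δ ζ)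
  set κ : ℂ := (n + 1) * toDist (fn (toWiener 0 le_rfl (undamp 0 q hqc hqs)) ^ (n + 1)) (Δ ζ)
    with hκ_def
  have hκ : 0 < ‖κ‖ := norm_pos_iff.2 (mul_ne_zero (by exact_mod_cast n.succ_ne_zero) hζ)
  set A := max A₀ (max A₁ 0)
  have hA : 0 ≤ A := (le_max_right _ _).trans (le_max_right _ _)
  set B := A + max C 1
  have hB1 : A + 1 ≤ B := add_le_add le_rfl (le_max_right _ _)
  have hB0 : 0 < B := by linarith
  set c := 2 + 2 ^ (n + 1) * B ^ n with hc
  have hc0 : 0 < c := by positivity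
  set K := (∫ x, ‖(Δ ζ) x‖) * (2 * B + (n + 1) * (2 * B) ^ n * (A + c * B))
  have hK : 0 ≤ K := mul_nonneg (integral_nonneg fun _ => norm_nonneg _) (by positivity)
  -- The error `K τ³ ρ²` must be at most half of the main term, which is at least `τ² ρ² ‖κ‖ / 4`.
  -- Neither `K` nor `κ` depends on `ρ` or `N`.
  obtain ⟨τ, hτ, hτc, hτK⟩ : ∃ τ : ℝ, 0 < τ ∧ c * τ ≤ 1 ∧ K * τ ≤ ‖κ‖ / 8 := by
    refine ⟨min c⁻¹ (‖κ‖ / 8 / (K + 1)), by positivity, ?_, ?_⟩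
    · calc c * min c⁻¹ _ ≤ c * c⁻¹ := by gcongr; exact min_le_left _ _
        _ = 1 := mul_inv_cancel₀ hc0.ne'
    · calc K * min c⁻¹ (‖κ‖ / 8 / (K + 1)) ≤ (K + 1) * (‖κ‖ / 8 / (K + 1)) := by
            gcongr
            · linarith
            · exact min_le_right _ _
        _ = ‖κ‖ / 8 := by field_simp
  -- Everything to be beaten by the remaining `τ² ρ² ‖κ‖ / 8`; the 1 stands for the pairing of `ρ²
  -- β_N`.
  set M := 1 + 2 * A * (∫ x, ‖(ζ - Δ ζ) x‖) + K * τ ^ 2 + D * ε⁻¹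
  obtain ⟨ρ, hρ1, hρε, hρM⟩ : ∃ ρ : ℝ, 1 ≤ ρ ∧ τ / ε < ρ ∧ M < τ ^ 2 * ‖κ‖ / 8 * ρ := by
    have h := tendsto_id.const_mul_atTop (show 0 < τ ^ 2 * ‖κ‖ / 8 by positivity)
    exact ((eventually_ge_atTop 1).and ((eventually_gt_atTop _).and
      (h.eventually_gt_atTop M))).exists
  have hδ : ∀ N : ℕ, 0 < 1 / (N + 1 : ℝ) := fun N => Nat.one_div_pos_of_nat
  have hδ1 : ∀ N : ℕ, 1 / (N + 1 : ℝ) ≤ 1 := fun N => by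
    rw [div_le_one (by positivity)]
    linarith [N.cast_nonneg (α := ℝ)]
  let b : ∀ N : ℕ, CI d := fun N => undamp (1 / (N + 1 : ℝ)) (twoBumps q e n N)
    (continuous_twoBumps hqc e n N) (hasCompactSupport_twoBumps hqs e n N)
  let f : ℕ → WienerAlgebra d := fun N => toWiener (1 / (N + 1 : ℝ)) (hδ N).le (b N)
  have hf : ∀ N, (f N : Space d → ℂ) =ᵐ[volume] twoBumps q e n N := fun N =>
    toWiener_undamp _ _ _ _ _
  have hg := toWiener_undamp 0 le_rfl q hqc hqs
  have e1 := (tendsto_toDist_twoBumps_pow hqc hqs he hf hg (Δ ζ)).norm.eventually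
    (lt_mem_nhds (half_lt_self hκ))
  have e2 := (((tendsto_toDist_twoBumps hqc hqs he hn hf hg (ζ - Δ ζ)).norm.const_mul
    (ρ ^ 2))).eventually (gt_mem_nhds (show ρ ^ 2 * ‖(0 : ℂ)‖ < 1 by simp))
  have e3 := (tendsto_sobolevNorm_smul_twoBumps hs hqc hqs he hn (ρ ^ 2) hf).eventually
    (gt_mem_nhds (show (0 : ℝ≥0∞) < ENNReal.ofReal (ε / 4) from pos_iff_ne_zero.2 hε4))
  -- `N` is chosen last, when the amplitude `ρ²` is fixed, so that `ρ² β_N` is small in `H^s` and in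
  -- the linear pairing.
  obtain ⟨N, h1, h2, h3⟩ := (e1.and (e2.and e3)).exists
  obtain ⟨v, hsol, hv0, hdt, hlow⟩ := exists_isSolution_lower_bound (hδ N).le hn hA hB1 hc hτ hτc
    hρ1 ((hA₀ _ (hδ1 N)).trans (le_max_left _ _))
    (β := b N) (by
      have : B - A = max C 1 := add_sub_cancel_left _ _
      rw [this]
      exact (hC N).trans (le_max_left _ _))
    ((hA₁ _ (hδ1 N)).trans ((le_max_left _ _).trans (le_max_right _ _))) ζ
  refine ⟨τ / ρ ^ n, _, τ / ρ ^ n, hsol, by positivity, ?_, le_rfl, ?_,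
    memSobolev_toWiener (hδ N) σ _, ?_⟩
  · have : ρ ≤ ρ ^ n := le_self_pow₀ hρ1 (by omega)
    rw [div_lt_iff₀ (by positivity)]
    rw [div_lt_iff₀ hε] at hρε
    nlinarith
  · have hsum : ENNReal.ofReal ε
        = ENNReal.ofReal (ε / 4) + ENNReal.ofReal (ε / 4)
          + (ENNReal.ofReal (ε / 4) + ENNReal.ofReal (ε / 4)) := by
      rw [← ENNReal.ofReal_add, ← ENNReal.ofReal_add]
      · congr 1; ring
      all_goals positivity
    rw [sobolevPairNorm, hdt, hv0, map_add, map_smul, toDist_fn_add, add_sub_right_comm, hsum]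
    refine ENNReal.add_lt_add_of_lt_of_le ?_ ?_ ?_
    · exact ((ha₁ _ (toWiener_undamp _ _ _ _ _)).trans_lt ENNReal.ofReal_lt_top).ne
    · refine (sobolevNorm_add_le _ _ _).trans_lt ?_
      refine ENNReal.add_lt_add_of_le_of_lt ?_ (ha₀ _ (toWiener_undamp _ _ _ _ _)) h3
      exact ((ha₀ _ (toWiener_undamp _ _ _ _ _)).trans_lt ENNReal.ofReal_lt_top).ne
    · exact (ha₁ _ (toWiener_undamp _ _ _ _ _)).trans le_self_add
  · set y := toDist (fn (toWiener (1 / (N + 1 : ℝ)) (hδ N).le (v (τ / ρ ^ n)))) (ζ - Δ ζ) with hy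
    have hρ2 : ρ ≤ ρ ^ 2 := le_self_pow₀ hρ1 two_ne_zero
    have hbig : D * ε⁻¹ < ‖y‖ := by
      have i1 : τ ^ 2 / 2 * ρ ^ 2 * (‖κ‖ / 2)
          ≤ τ ^ 2 / 2 * ρ ^ 2 * ‖toDist (fn (f N) ^ (n + 1)) (Δ ζ)‖ := by gcongr
      have i2 : τ ^ 2 * ρ ^ 2 * (K * τ) ≤ τ ^ 2 * ρ ^ 2 * (‖κ‖ / 8) := by gcongr
      have i3 : τ ^ 2 * ‖κ‖ / 8 * ρ ≤ τ ^ 2 * ‖κ‖ / 8 * ρ ^ 2 := by gcongr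
      have i4 : K * (τ ^ 2 * (1 + ρ ^ 2 * τ)) = K * τ ^ 2 + τ ^ 2 * ρ ^ 2 * (K * τ) := by ring
      have i5 : τ ^ 2 / 2 * ρ ^ 2 * ‖toDist (fn (f N) ^ (n + 1)) (Δ ζ)‖
          ≤ ‖y‖ + ρ ^ 2 * ‖toDist (fn (f N)) (ζ - Δ ζ)‖ + 2 * A * (∫ x, ‖(ζ - Δ ζ) x‖)
            + K * (τ ^ 2 * (1 + ρ ^ 2 * τ)) := hlow
      have i6 : 1 + 2 * A * (∫ x, ‖(ζ - Δ ζ) x‖) + K * τ ^ 2 + D * ε⁻¹ < τ ^ 2 * ‖κ‖ / 8 * ρ := hρM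
      linarith
    have hp := hpair (toDist (fn (toWiener (1 / (N + 1 : ℝ)) (hδ N).le (v (τ / ρ ^ n)))))
    by_contra hle
    rw [not_lt] at hle
    have hcon : ‖y‖ₑ ≤ ENNReal.ofReal (D * ε⁻¹) := by
      rw [ENNReal.ofReal_mul hD.le]
      exact hp.trans (by gcongr)
    rw [← ofReal_norm, ENNReal.ofReal_le_ofReal_iff (by positivity)] at hcon
    linarith
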